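/- A polyhedron is given by the finite set $P\subset\mathbb R^3$ of its vertices, and $\overline P$ denotes the convex hull of $P$. Say that $P$ has \emph{Rupert's property} if there are a congruent copy $Q$ of $P$ and a nonzero vector $v\in\mathbb R^3$ such that $$\overline P\setminus\bigcup_{t\in\mathbb R}\bigl(\overline Q+tv\bigr)$$ is a set with a hole, that is, a set whose interior is connected but not simply connected. Let $J1,\dots,J92$ be the 92 Johnson solids (the convex polyhedra with regular faces that are not uniform) in Johnson's standard numbering, each determined up to similarity. Then $Jn$ has Rupert's property for every $n\in\{1,\dots,92\}$ with $$n\notin\{25,\,45,\,47,\,71,\,72,\,73,\,74,\,75,\,76,\,77\}.$$ In particular, at least 82 of the 92 Johnson solids have Rupert's property. (Nothing is claimed about the ten solids left out.) -/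

import Mathlib

namespace JohnsonSolids

/-- Euclidean three-space. -/
abbrev Space : Type := EuclideanSpace ℝ (Fin 3)

/-! ### The Rupert property -/

/-- A set with a hole: its interior is connected but not simply connected. -/
def IsSetWithHole (S : Set Space) : Prop :=
  IsConnected (interior S) ∧ ¬ IsSimplyConnected (interior S)

/-- The region swept by the convex hull of `Q` when it is moved along the straight line with
direction `v`, that is, the union of all `conv Q + t v` with `t` real. -/
def tunnel (Q : Set Space) (v : Space) : Set Space :=
  {x | ∃ t : ℝ, ∃ q ∈ convexHull ℝ Q, x = q + t • v}

/-- The polyhedron with vertex set `P` has Rupert's property: for some congruent copy `Q` of `P`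
and some direction `v`, removing the straight tunnel of `Q` in direction `v` from the solid
`conv P` leaves a set with a hole. -/
def HasRupertProperty (P : Set Space) : Prop :=
  ∃ (f : Space ≃ᵢ Space) (v : Space), v ≠ 0 ∧
    IsSetWithHole (convexHull ℝ P \ tunnel (f '' P) v)

/-! ### Building blocks for the vertex sets -/

noncomputable section

/-- The point with the given coordinates. -/
def pt (x y z : ℝ) : Space := !₂[x, y, z]

/-- The vertices of the regular `n`-gon of circumradius `r` in the horizontal plane at height `z`,
centred on the vertical axis, with one vertex in direction `θ`. -/
def ring (n : ℕ) (r θ z : ℝ) : Set Space :=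
  Set.range fun k : Fin n =>
    pt (r * Real.cos (θ + 2 * Real.pi * (k : ℕ) / n))
      (r * Real.sin (θ + 2 * Real.pi * (k : ℕ) / n)) z

/-- The circumradius of the regular `n`-gon with side `1`. -/
def circumradius (n : ℕ) : ℝ := 1 / (2 * Real.sin (Real.pi / n))

/-- The inradius of the regular `n`-gon with side `1`. -/
def inradius (n : ℕ) : ℝ := 1 / (2 * Real.tan (Real.pi / n))

/-- The regular `n`-gon with side `1` at height `z`, with one vertex in direction `θ`. -/
def ngon (n : ℕ) (θ z : ℝ) : Set Space := ring n (circumradius n) θ z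

/-- The height of the `n`-gonal pyramid with all edges `1`. It is also the height of the
`n`-gonal cupola with all edges `1`. -/
def capHeight (n : ℕ) : ℝ := √(1 - circumradius n ^ 2)

/-- The height of the `n`-gonal antiprism with all edges `1`: adjacent vertices of its two bases are
at horizontal distance `1 / (2 cos (π / (2 n)))`. -/
def antiprismHeight (n : ℕ) : ℝ := √(1 - (1 / (2 * Real.cos (Real.pi / (2 * n)))) ^ 2)

/-- The vertices, other than those of the decagonal base, of the pentagonal rotunda with edges `1`
on the decagon at height `z`; it points upwards if `s = 1` and downwards if `s = -1`, and the
small pentagon has a vertex in direction `θ`. The rotunda is half of an icosidodecahedron, whose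
vertices have distance `φ` from the centre of the decagon. -/
def rotundaCap (θ z s : ℝ) : Set Space :=
  ring 5 (Real.goldenRatio * circumradius 5) (θ + Real.pi / 5)
      (z + s * √(Real.goldenRatio ^ 2 - (Real.goldenRatio * circumradius 5) ^ 2)) ∪
    ngon 5 θ (z + s * √(Real.goldenRatio ^ 2 - circumradius 5 ^ 2))

/-- The vertices of the right `n`-gonal prism with all edges `1`, centred at the origin; the
centres of its lateral squares are in the directions `2 π k / n`. -/
def prism (n : ℕ) : Set Space :=
  ngon n (Real.pi / n) (1 / 2) ∪ ngon n (Real.pi / n) (-(1 / 2))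

/-- The apex of the square pyramid with edges `1` erected on the `k`-th lateral square of the
prism. -/
def prismApex (n k : ℕ) : Space :=
  pt ((inradius n + capHeight 4) * Real.cos (2 * Real.pi * k / n))
    ((inradius n + capHeight 4) * Real.sin (2 * Real.pi * k / n)) 0

/-- All points `(± x, ± y, ± z)`. -/
def signed (x y z : ℝ) : Set Space :=
  {pt x y z, pt x y (-z), pt x (-y) z, pt x (-y) (-z),
    pt (-x) y z, pt (-x) y (-z), pt (-x) (-y) z, pt (-x) (-y) (-z)}

/-- The cyclic permutations of `(x, y, z)`. -/
def cyc (x y z : ℝ) : Set Space := {pt x y z, pt y z x, pt z x y}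

/-- All even permutations of `(± x, ± y, ± z)`. -/
def signedCyc (x y z : ℝ) : Set Space := signed x y z ∪ signed y z x ∪ signed z x y

/-- The points `(± x, ± y, ± z)` with an even number of sign changes. -/
def evenSigned (x y z : ℝ) : Set Space :=
  {pt x y z, pt x (-y) (-z), pt (-x) y (-z), pt (-x) (-y) z}

/-- The points `(± x, ± y, z)`. -/
def signedPair (x y z : ℝ) : Set Space :=
  {pt x y z, pt x (-y) z, pt (-x) y z, pt (-x) (-y) z}

local notation "φ" => Real.goldenRatio

/-- The icosahedron with edge `2`. -/
def icosahedron : Set Space := signedCyc 0 φ 1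

/-- The dodecahedron with edge `2 / φ`; its faces are orthogonal to the vertices of
`icosahedron`. -/
def dodecahedron : Set Space := signed 1 1 1 ∪ signedCyc 0 φ⁻¹ φ

/-- The truncated tetrahedron with edge `2 √2`. -/
def truncatedTetrahedron : Set Space := evenSigned 1 1 3 ∪ evenSigned 1 3 1 ∪ evenSigned 3 1 1

/-- The truncated cube with edge `2`. -/
def truncatedCube : Set Space := signedCyc 1 (1 + √2) (1 + √2)

/-- The truncated dodecahedron with edge `2 / φ`; its decagonal faces are orthogonal to the vertices
of `icosahedron`. -/
def truncatedDodecahedron : Set Space :=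
  signedCyc 0 φ⁻¹ (2 + φ) ∪ signedCyc φ⁻¹ φ (2 * φ) ∪ signedCyc φ 2 (φ + 1)

/-- The rhombicosidodecahedron with edge `2`; its pentagonal faces are orthogonal to the vertices of
`icosahedron`. -/
def rhombicosidodecahedron : Set Space :=
  signedCyc 1 1 (φ ^ 3) ∪ signedCyc (φ ^ 2) φ (2 * φ) ∪ signedCyc (2 + φ) 0 (φ ^ 2)

/-- Three vertices of `icosahedron`, no two of which are adjacent or opposite. -/
def axis₁ : Space := pt 0 φ (-1)

/-- The second of the three axes. -/
def axis₂ : Space := pt (-1) 0 φ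

/-- The third of the three axes. -/
def axis₃ : Space := pt φ (-1) 0

/-- The apex of the regular pentagonal pyramid erected on the face of `dodecahedron` with outer
normal `u`, a vertex of `icosahedron`. -/
def dodecahedronApex (u : Space) : Space := ((7 * φ - 6) / 5) • u

/-- The small pentagon of the pentagonal cupola erected on the face of `truncatedDodecahedron` with
outer normal `u`, a vertex of `icosahedron`. It is a scaled copy of the pentagon formed by the
neighbours `w` of `u` in `icosahedron`. -/
def truncatedDodecahedronCap (u : Space) : Set Space :=
  {x | ∃ w ∈ icosahedron, inner ℝ u w = φ ∧ x = ((12 * φ - 11) / 5) • u + φ⁻¹ • w}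

/-- The small square of the square cupola erected on the face of `truncatedCube` in the plane
`z = 1 + √2` if `s = 1`, and on the opposite face if `s = -1`. -/
def truncatedCubeCap (s : ℝ) : Set Space :=
  {pt √2 0 (s * (1 + 2 * √2)), pt (-√2) 0 (s * (1 + 2 * √2)),
    pt 0 √2 (s * (1 + 2 * √2)), pt 0 (-√2) (s * (1 + 2 * √2))}

/-- The vertices of the pentagonal face of `rhombicosidodecahedron` with outer normal `u`, a vertex
of `icosahedron`. They are the vertices of a pentagonal cupola that are not on its decagon. -/
def rhombicosidodecahedronCap (u : Space) : Set Space :=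
  {x | x ∈ rhombicosidodecahedron ∧ inner ℝ x u = 3 * φ + 3}

/-- The half-turn about the line through the origin spanned by `u`. On a pentagonal cupola with
axis `u` it preserves the decagon and turns the small pentagon by 36 degrees. -/
def halfTurn (u x : Space) : Space := (2 * inner ℝ x u / inner ℝ u u) • u - x

/-- The rhombicosidodecahedron with the pentagonal cupolas around the normals in `D` cut off
(diminished) and those around the normals in `G` turned by 36 degrees (gyrated). -/
def modifiedRhombicosidodecahedron (D G : Set Space) : Set Space :=
  {x | x ∈ rhombicosidodecahedron ∧ ∀ u ∈ D ∪ G, x ∉ rhombicosidodecahedronCap u} ∪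
    {y | ∃ u ∈ G, ∃ x ∈ rhombicosidodecahedronCap u, y = halfTurn u x}

/-! The remaining solids depend on real algebraic numbers, each given as the only root of an
equation in a short interval. -/

/-- The positive root of `2 x³ + 11 x² + 4 x - 1`, about `0.16902`. -/
def root84 : ℝ := sInf {x | x ∈ Set.Icc 0.16902222 0.16902223 ∧
  2 * x ^ 3 + 11 * x ^ 2 + 4 * x - 1 = 0}

/-- The circumradius of the two inner squares of vertices in the snub square antiprism with
edges `1`, about `1.21321`. -/
def root85 : ℝ := sInf {r | r ∈ Set.Icc 1.21320554 1.21320555 ∧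
  (√(1 / 2 + √2 * r - r ^ 2) - √(1 / 2 + r - r ^ 2)) ^ 2 = 1 - (2 - √2) * r ^ 2}

/-- About `0.85273`. -/
def root86 : ℝ := (6 + √6 + 2 * √(213 - 57 * √6)) / 30

/-- The smallest positive root of the polynomial below, about `0.59463`. -/
def root88 : ℝ := sInf {x | x ∈ Set.Icc 0.59463333 0.59463334 ∧
  1680 * x ^ 16 - 4800 * x ^ 15 - 3712 * x ^ 14 + 17216 * x ^ 13 + 1568 * x ^ 12
    - 24576 * x ^ 11 + 2464 * x ^ 10 + 17248 * x ^ 9 - 3384 * x ^ 8 - 5584 * x ^ 7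
    + 2000 * x ^ 6 + 240 * x ^ 5 - 776 * x ^ 4 + 304 * x ^ 3 + 200 * x ^ 2 - 56 * x - 23 = 0}

/-- A root of the polynomial below, about `0.21684`. -/
def root89 : ℝ := sInf {x | x ∈ Set.Icc 0.21684481 0.21684482 ∧
  26880 * x ^ 10 + 35328 * x ^ 9 - 25600 * x ^ 8 - 39680 * x ^ 7 + 6112 * x ^ 6
    + 13696 * x ^ 5 + 2128 * x ^ 4 - 1808 * x ^ 3 - 1119 * x ^ 2 + 494 * x - 47 = 0}

/-- A root of the polynomial below, about `0.76713`. -/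
def root90 : ℝ := sInf {x | x ∈ Set.Icc 0.76713111 0.76713112 ∧
  256 * x ^ 12 - 512 * x ^ 11 - 1664 * x ^ 10 + 3712 * x ^ 9 + 1552 * x ^ 8
    - 6592 * x ^ 7 + 1248 * x ^ 6 + 4352 * x ^ 5 - 2024 * x ^ 4 - 944 * x ^ 3
    + 672 * x ^ 2 - 24 * x - 23 = 0}

/-- The spheno complex: two unit squares with a common edge, at the distance `2 k` between the
opposite edges, and the four equilateral triangles at their ends. -/
def spheno (k : ℝ) : Set Space :=
  signedPair 0 (1 / 2) √(1 - k ^ 2) ∪ signedPair k (1 / 2) 0 ∪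
    signedPair 0 (1 / 2 + √(3 / 4 - k ^ 2) / √(1 - k ^ 2)) ((1 / 2 - k ^ 2) / √(1 - k ^ 2))

/-! ### The 92 solids -/

/-- J1, the square pyramid. -/
def J1 : Set Space :=
  ngon 4 0 0 ∪ {pt 0 0 (capHeight 4)}

/-- J2, the pentagonal pyramid. -/
def J2 : Set Space :=
  ngon 5 0 0 ∪ {pt 0 0 (capHeight 5)}

/-- J3, the triangular cupola. -/
def J3 : Set Space :=
  ngon 6 (Real.pi / 6) 0 ∪ ngon 3 0 (capHeight 3)

/-- J4, the square cupola. -/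
def J4 : Set Space :=
  ngon 8 (Real.pi / 8) 0 ∪ ngon 4 0 (capHeight 4)

/-- J5, the pentagonal cupola. -/
def J5 : Set Space :=
  ngon 10 (Real.pi / 10) 0 ∪ ngon 5 0 (capHeight 5)

/-- J6, the pentagonal rotunda. -/
def J6 : Set Space :=
  ngon 10 (Real.pi / 10) 0 ∪ rotundaCap 0 0 1

/-- J7, the elongated triangular pyramid. -/
def J7 : Set Space :=
  ngon 3 0 0 ∪ ngon 3 0 (-1) ∪ {pt 0 0 (capHeight 3)}

/-- J8, the elongated square pyramid. -/
def J8 : Set Space :=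
  ngon 4 0 0 ∪ ngon 4 0 (-1) ∪ {pt 0 0 (capHeight 4)}

/-- J9, the elongated pentagonal pyramid. -/
def J9 : Set Space :=
  ngon 5 0 0 ∪ ngon 5 0 (-1) ∪ {pt 0 0 (capHeight 5)}

/-- J10, the gyroelongated square pyramid. -/
def J10 : Set Space :=
  ngon 4 0 0 ∪ ngon 4 (Real.pi / 4) (-antiprismHeight 4) ∪ {pt 0 0 (capHeight 4)}

/-- J11, the gyroelongated pentagonal pyramid. -/
def J11 : Set Space :=
  ngon 5 0 0 ∪ ngon 5 (Real.pi / 5) (-antiprismHeight 5) ∪ {pt 0 0 (capHeight 5)}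

/-- J12, the triangular bipyramid. -/
def J12 : Set Space :=
  ngon 3 0 0 ∪ {pt 0 0 (capHeight 3), pt 0 0 (-capHeight 3)}

/-- J13, the pentagonal bipyramid. -/
def J13 : Set Space :=
  ngon 5 0 0 ∪ {pt 0 0 (capHeight 5), pt 0 0 (-capHeight 5)}

/-- J14, the elongated triangular bipyramid. -/
def J14 : Set Space :=
  ngon 3 0 0 ∪ ngon 3 0 (-1) ∪
    {pt 0 0 (capHeight 3), pt 0 0 (-1 - capHeight 3)}

/-- J15, the elongated square bipyramid. -/
def J15 : Set Space :=
  ngon 4 0 0 ∪ ngon 4 0 (-1) ∪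
    {pt 0 0 (capHeight 4), pt 0 0 (-1 - capHeight 4)}

/-- J16, the elongated pentagonal bipyramid. -/
def J16 : Set Space :=
  ngon 5 0 0 ∪ ngon 5 0 (-1) ∪
    {pt 0 0 (capHeight 5), pt 0 0 (-1 - capHeight 5)}

/-- J17, the gyroelongated square bipyramid. -/
def J17 : Set Space :=
  ngon 4 0 0 ∪ ngon 4 (Real.pi / 4) (-antiprismHeight 4) ∪
    {pt 0 0 (capHeight 4), pt 0 0 (-antiprismHeight 4 - capHeight 4)}

/-- J18, the elongated triangular cupola. -/
def J18 : Set Space :=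
  ngon 6 (Real.pi / 6) 0 ∪ ngon 6 (Real.pi / 6) (-1) ∪ ngon 3 0 (capHeight 3)

/-- J19, the elongated square cupola. -/
def J19 : Set Space :=
  ngon 8 (Real.pi / 8) 0 ∪ ngon 8 (Real.pi / 8) (-1) ∪ ngon 4 0 (capHeight 4)

/-- J20, the elongated pentagonal cupola. -/
def J20 : Set Space :=
  ngon 10 (Real.pi / 10) 0 ∪ ngon 10 (Real.pi / 10) (-1) ∪ ngon 5 0 (capHeight 5)

/-- J21, the elongated pentagonal rotunda. -/
def J21 : Set Space :=
  ngon 10 (Real.pi / 10) 0 ∪ ngon 10 (Real.pi / 10) (-1) ∪ rotundaCap 0 0 1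

/-- J22, the gyroelongated triangular cupola. -/
def J22 : Set Space :=
  ngon 6 (Real.pi / 6) 0 ∪ ngon 6 0 (-antiprismHeight 6) ∪ ngon 3 0 (capHeight 3)

/-- J23, the gyroelongated square cupola. -/
def J23 : Set Space :=
  ngon 8 (Real.pi / 8) 0 ∪ ngon 8 0 (-antiprismHeight 8) ∪ ngon 4 0 (capHeight 4)

/-- J24, the gyroelongated pentagonal cupola. -/
def J24 : Set Space :=
  ngon 10 (Real.pi / 10) 0 ∪ ngon 10 0 (-antiprismHeight 10) ∪ ngon 5 0 (capHeight 5)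

/-- J25, the gyroelongated pentagonal rotunda. -/
def J25 : Set Space :=
  ngon 10 (Real.pi / 10) 0 ∪ ngon 10 0 (-antiprismHeight 10) ∪ rotundaCap 0 0 1

/-- J26, the gyrobifastigium. -/
def J26 : Set Space :=
  signedPair (1 / 2) (1 / 2) 0 ∪
    {pt (1 / 2) 0 (√3 / 2), pt (-(1 / 2)) 0 (√3 / 2),
      pt 0 (1 / 2) (-(√3 / 2)), pt 0 (-(1 / 2)) (-(√3 / 2))}

/-- J27, the triangular orthobicupola. -/
def J27 : Set Space :=
  ngon 6 (Real.pi / 6) 0 ∪ ngon 3 0 (capHeight 3) ∪ ngon 3 0 (-capHeight 3)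

/-- J28, the square orthobicupola. -/
def J28 : Set Space :=
  ngon 8 (Real.pi / 8) 0 ∪ ngon 4 0 (capHeight 4) ∪ ngon 4 0 (-capHeight 4)

/-- J29, the square gyrobicupola. -/
def J29 : Set Space :=
  ngon 8 (Real.pi / 8) 0 ∪ ngon 4 0 (capHeight 4) ∪ ngon 4 (Real.pi / 4) (-capHeight 4)

/-- J30, the pentagonal orthobicupola. -/
def J30 : Set Space :=
  ngon 10 (Real.pi / 10) 0 ∪ ngon 5 0 (capHeight 5) ∪ ngon 5 0 (-capHeight 5)

/-- J31, the pentagonal gyrobicupola. -/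
def J31 : Set Space :=
  ngon 10 (Real.pi / 10) 0 ∪ ngon 5 0 (capHeight 5) ∪ ngon 5 (Real.pi / 5) (-capHeight 5)

/-- J32, the pentagonal orthocupolarotunda. -/
def J32 : Set Space :=
  ngon 10 (Real.pi / 10) 0 ∪ ngon 5 0 (capHeight 5) ∪ rotundaCap 0 0 (-1)

/-- J33, the pentagonal gyrocupolarotunda. -/
def J33 : Set Space :=
  ngon 10 (Real.pi / 10) 0 ∪ ngon 5 0 (capHeight 5) ∪ rotundaCap (Real.pi / 5) 0 (-1)

/-- J34, the pentagonal orthobirotunda. -/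
def J34 : Set Space :=
  ngon 10 (Real.pi / 10) 0 ∪ rotundaCap 0 0 1 ∪ rotundaCap 0 0 (-1)

/-- J35, the elongated triangular orthobicupola. -/
def J35 : Set Space :=
  ngon 6 (Real.pi / 6) 0 ∪ ngon 6 (Real.pi / 6) (-1) ∪ ngon 3 0 (capHeight 3) ∪
    ngon 3 0 (-1 - capHeight 3)

/-- J36, the elongated triangular gyrobicupola. -/
def J36 : Set Space :=
  ngon 6 (Real.pi / 6) 0 ∪ ngon 6 (Real.pi / 6) (-1) ∪ ngon 3 0 (capHeight 3) ∪
    ngon 3 (Real.pi / 3) (-1 - capHeight 3)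

/-- J37, the elongated square gyrobicupola. -/
def J37 : Set Space :=
  ngon 8 (Real.pi / 8) 0 ∪ ngon 8 (Real.pi / 8) (-1) ∪ ngon 4 0 (capHeight 4) ∪
    ngon 4 (Real.pi / 4) (-1 - capHeight 4)

/-- J38, the elongated pentagonal orthobicupola. -/
def J38 : Set Space :=
  ngon 10 (Real.pi / 10) 0 ∪ ngon 10 (Real.pi / 10) (-1) ∪ ngon 5 0 (capHeight 5) ∪
    ngon 5 0 (-1 - capHeight 5)

/-- J39, the elongated pentagonal gyrobicupola. -/
def J39 : Set Space :=
  ngon 10 (Real.pi / 10) 0 ∪ ngon 10 (Real.pi / 10) (-1) ∪ ngon 5 0 (capHeight 5) ∪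
    ngon 5 (Real.pi / 5) (-1 - capHeight 5)

/-- J40, the elongated pentagonal orthocupolarotunda. -/
def J40 : Set Space :=
  ngon 10 (Real.pi / 10) 0 ∪ ngon 10 (Real.pi / 10) (-1) ∪ ngon 5 0 (capHeight 5) ∪
    rotundaCap 0 (-1) (-1)

/-- J41, the elongated pentagonal gyrocupolarotunda. -/
def J41 : Set Space :=
  ngon 10 (Real.pi / 10) 0 ∪ ngon 10 (Real.pi / 10) (-1) ∪ ngon 5 0 (capHeight 5) ∪
    rotundaCap (Real.pi / 5) (-1) (-1)

/-- J42, the elongated pentagonal orthobirotunda. -/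
def J42 : Set Space :=
  ngon 10 (Real.pi / 10) 0 ∪ ngon 10 (Real.pi / 10) (-1) ∪ rotundaCap 0 0 1 ∪ rotundaCap 0 (-1) (-1)

/-- J43, the elongated pentagonal gyrobirotunda. -/
def J43 : Set Space :=
  ngon 10 (Real.pi / 10) 0 ∪ ngon 10 (Real.pi / 10) (-1) ∪ rotundaCap 0 0 1 ∪ rotundaCap (Real.pi / 5) (-1) (-1)

/-- J44, the gyroelongated triangular bicupola. -/
def J44 : Set Space :=
  ngon 6 (Real.pi / 6) 0 ∪ ngon 6 0 (-antiprismHeight 6) ∪ ngon 3 0 (capHeight 3) ∪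
    ngon 3 (Real.pi / 6) (-antiprismHeight 6 - capHeight 3)

/-- J45, the gyroelongated square bicupola. -/
def J45 : Set Space :=
  ngon 8 (Real.pi / 8) 0 ∪ ngon 8 0 (-antiprismHeight 8) ∪ ngon 4 0 (capHeight 4) ∪
    ngon 4 (Real.pi / 8) (-antiprismHeight 8 - capHeight 4)

/-- J46, the gyroelongated pentagonal bicupola. -/
def J46 : Set Space :=
  ngon 10 (Real.pi / 10) 0 ∪ ngon 10 0 (-antiprismHeight 10) ∪ ngon 5 0 (capHeight 5) ∪
    ngon 5 (Real.pi / 10) (-antiprismHeight 10 - capHeight 5)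

/-- J47, the gyroelongated pentagonal cupolarotunda. -/
def J47 : Set Space :=
  ngon 10 (Real.pi / 10) 0 ∪ ngon 10 0 (-antiprismHeight 10) ∪ ngon 5 0 (capHeight 5) ∪
    rotundaCap (Real.pi / 10) (-antiprismHeight 10) (-1)

/-- J48, the gyroelongated pentagonal birotunda. -/
def J48 : Set Space :=
  ngon 10 (Real.pi / 10) 0 ∪ ngon 10 0 (-antiprismHeight 10) ∪ rotundaCap 0 0 1 ∪
    rotundaCap (Real.pi / 10) (-antiprismHeight 10) (-1)

/-- J49, the augmented triangular prism. -/
def J49 : Set Space :=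
  prism 3 ∪ {prismApex 3 0}

/-- J50, the biaugmented triangular prism. -/
def J50 : Set Space :=
  prism 3 ∪ {prismApex 3 0, prismApex 3 1}

/-- J51, the triaugmented triangular prism. -/
def J51 : Set Space :=
  prism 3 ∪ {prismApex 3 0, prismApex 3 1, prismApex 3 2}

/-- J52, the augmented pentagonal prism. -/
def J52 : Set Space :=
  prism 5 ∪ {prismApex 5 0}

/-- J53, the biaugmented pentagonal prism. -/
def J53 : Set Space :=
  prism 5 ∪ {prismApex 5 0, prismApex 5 2}

/-- J54, the augmented hexagonal prism. -/
def J54 : Set Space :=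
  prism 6 ∪ {prismApex 6 0}

/-- J55, the parabiaugmented hexagonal prism. -/
def J55 : Set Space :=
  prism 6 ∪ {prismApex 6 0, prismApex 6 3}

/-- J56, the metabiaugmented hexagonal prism. -/
def J56 : Set Space :=
  prism 6 ∪ {prismApex 6 0, prismApex 6 2}

/-- J57, the triaugmented hexagonal prism. -/
def J57 : Set Space :=
  prism 6 ∪ {prismApex 6 0, prismApex 6 2, prismApex 6 4}

/-- J58, the augmented dodecahedron. -/
def J58 : Set Space :=
  dodecahedron ∪ {dodecahedronApex axis₁}

/-- J59, the parabiaugmented dodecahedron. -/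
def J59 : Set Space :=
  dodecahedron ∪ {dodecahedronApex axis₁, dodecahedronApex (-axis₁)}

/-- J60, the metabiaugmented dodecahedron. -/
def J60 : Set Space :=
  dodecahedron ∪ {dodecahedronApex axis₁, dodecahedronApex axis₂}

/-- J61, the triaugmented dodecahedron. -/
def J61 : Set Space :=
  dodecahedron ∪ {dodecahedronApex axis₁, dodecahedronApex axis₂, dodecahedronApex axis₃}

/-- J62, the metabidiminished icosahedron. -/
def J62 : Set Space :=
  icosahedron \ {axis₁, axis₂}

/-- J63, the tridiminished icosahedron. -/
def J63 : Set Space :=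
  icosahedron \ {axis₁, axis₂, axis₃}

/-- J64, the augmented tridiminished icosahedron. -/
def J64 : Set Space :=
  icosahedron \ {axis₁, axis₂, axis₃} ∪
    {pt ((φ ^ 2 + 2 * √2) / 3) ((φ ^ 2 + 2 * √2) / 3) ((φ ^ 2 + 2 * √2) / 3)}

/-- J65, the augmented truncated tetrahedron. -/
def J65 : Set Space :=
  truncatedTetrahedron ∪ cyc (-11 / 3) (-5 / 3) (-5 / 3)

/-- J66, the augmented truncated cube. -/
def J66 : Set Space :=
  truncatedCube ∪ truncatedCubeCap 1

/-- J67, the biaugmented truncated cube. -/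
def J67 : Set Space :=
  truncatedCube ∪ truncatedCubeCap 1 ∪ truncatedCubeCap (-1)

/-- J68, the augmented truncated dodecahedron. -/
def J68 : Set Space :=
  truncatedDodecahedron ∪ truncatedDodecahedronCap axis₁

/-- J69, the parabiaugmented truncated dodecahedron. -/
def J69 : Set Space :=
  truncatedDodecahedron ∪ truncatedDodecahedronCap axis₁ ∪ truncatedDodecahedronCap (-axis₁)

/-- J70, the metabiaugmented truncated dodecahedron. -/
def J70 : Set Space :=
  truncatedDodecahedron ∪ truncatedDodecahedronCap axis₁ ∪ truncatedDodecahedronCap axis₂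

/-- J71, the triaugmented truncated dodecahedron. -/
def J71 : Set Space :=
  truncatedDodecahedron ∪ truncatedDodecahedronCap axis₁ ∪ truncatedDodecahedronCap axis₂ ∪ truncatedDodecahedronCap axis₃

/-- J72, the gyrate rhombicosidodecahedron. -/
def J72 : Set Space :=
  modifiedRhombicosidodecahedron ∅ {axis₁}

/-- J73, the parabigyrate rhombicosidodecahedron. -/
def J73 : Set Space :=
  modifiedRhombicosidodecahedron ∅ {axis₁, -axis₁}

/-- J74, the metabigyrate rhombicosidodecahedron. -/
def J74 : Set Space :=
  modifiedRhombicosidodecahedron ∅ {axis₁, axis₂}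

/-- J75, the trigyrate rhombicosidodecahedron. -/
def J75 : Set Space :=
  modifiedRhombicosidodecahedron ∅ {axis₁, axis₂, axis₃}

/-- J76, the diminished rhombicosidodecahedron. -/
def J76 : Set Space :=
  modifiedRhombicosidodecahedron {axis₁} ∅

/-- J77, the paragyrate diminished rhombicosidodecahedron. -/
def J77 : Set Space :=
  modifiedRhombicosidodecahedron {axis₁} {-axis₁}

/-- J78, the metagyrate diminished rhombicosidodecahedron. -/
def J78 : Set Space :=
  modifiedRhombicosidodecahedron {axis₁} {axis₂}

/-- J79, the bigyrate diminished rhombicosidodecahedron. -/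
def J79 : Set Space :=
  modifiedRhombicosidodecahedron {axis₁} {axis₂, axis₃}

/-- J80, the parabidiminished rhombicosidodecahedron. -/
def J80 : Set Space :=
  modifiedRhombicosidodecahedron {axis₁, -axis₁} ∅

/-- J81, the metabidiminished rhombicosidodecahedron. -/
def J81 : Set Space :=
  modifiedRhombicosidodecahedron {axis₁, axis₂} ∅

/-- J82, the gyrate bidiminished rhombicosidodecahedron. -/
def J82 : Set Space :=
  modifiedRhombicosidodecahedron {axis₁, axis₂} {axis₃}

/-- J83, the tridiminished rhombicosidodecahedron. -/
def J83 : Set Space :=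
  modifiedRhombicosidodecahedron {axis₁, axis₂, axis₃} ∅

/-- J84, the snub disphenoid. -/
def J84 : Set Space :=
  let q := root84
  let r := √q
  let s := √((1 - q) / (2 * q))
  let t := √(2 - 2 * q)
  {pt t r 0, pt (-t) r 0, pt 0 (-r) t, pt 0 (-r) (-t),
    pt 1 (-s) 0, pt (-1) (-s) 0, pt 0 s 1, pt 0 s (-1)}

/-- J85, the snub square antiprism. -/
def J85 : Set Space :=
  let r := root85
  let u := √(1 / 2 + √2 * r - r ^ 2)
  let w := √(1 / 2 + r - r ^ 2)
  ngon 4 0 ((u + w) / 2) ∪ ring 4 r (Real.pi / 4) ((u - w) / 2) ∪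
    ring 4 r 0 (-((u - w) / 2)) ∪ ngon 4 (Real.pi / 4) (-((u + w) / 2))

/-- J86, the sphenocorona. -/
def J86 : Set Space :=
  let k := root86
  spheno k ∪ signedPair (1 / 2) 0 (-√(1 / 2 + k - k ^ 2))

/-- J87, the augmented sphenocorona. -/
def J87 : Set Space :=
  let k := root86
  let s := √(1 - k ^ 2)
  spheno k ∪ signedPair (1 / 2) 0 (-√(1 / 2 + k - k ^ 2)) ∪
    {pt (k / 2 + s / √2) 0 (s / 2 + k / √2)}

/-- J88, the sphenomegacorona. -/
def J88 : Set Space :=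
  let k := root88
  let s := √(1 - k ^ 2)
  spheno k ∪ signedPair (1 / 2) 0 (-√(1 / 2 + k - k ^ 2)) ∪
    signedPair 0 (1 / 2 + √(3 / 4 - k ^ 2) * (1 - 2 * k ^ 2) / s ^ 3)
      ((2 * k ^ 4 - 1) / (2 * s ^ 3))

/-- J89, the hebesphenomegacorona. -/
def J89 : Set Space :=
  let k := root89
  let s := √(1 - k ^ 2)
  let z := (1 - k - 2 * k ^ 2) / (2 * s)
  let y := √(1 - (1 / 2 + k) ^ 2 - z ^ 2)
  let c := 1 - 1 / (2 * (1 - (1 / 2 + k) ^ 2))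
  let d := √(1 - c ^ 2)
  signedPair (1 / 2) (1 / 2) s ∪ signedPair (1 / 2 + k) (1 / 2) 0 ∪
    signedPair 0 (1 / 2 + y) z ∪ signedPair 0 (1 / 2 + y * c + z * d) (z * c - y * d) ∪
    signedPair (1 / 2) 0 (-√(3 / 4 - k ^ 2))

/-- J90, the disphenocingulum. -/
def J90 : Set Space :=
  let k := root90
  let s := √(1 - k ^ 2)
  let y := 1 / 2 + √(3 / 4 - k ^ 2) / s
  let z := (1 / 2 - k ^ 2) / s
  let c := -√(1 - 2 * (k - 1 / 2) ^ 2)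
  spheno k ∪ signedPair (1 / 2) 0 (c - s) ∪ signedPair (1 / 2) k c ∪ signedPair y 0 (c - z)

/-- J91, the bilunabirotunda. -/
def J91 : Set Space :=
  signed 0 0 φ ∪ signed 1 φ 1 ∪ signed (φ ^ 2) 1 0

/-- J92, the triangular hebesphenorotunda. -/
def J92 : Set Space :=
  cyc 1 φ (φ ^ 2) ∪ cyc 0 0 (2 * φ) ∪ cyc (-1) φ (φ ^ 2) ∪ cyc 1 (-φ) (φ ^ 2) ∪
    cyc (-1) φ (-φ⁻¹) ∪ cyc 1 (-φ) φ⁻¹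

/-- The vertex sets of the Johnson solids `J1`, ..., `J92` in the standard numbering, each for one
convenient choice of position and scale. -/
def vertices (n : ℕ) : Set Space :=
  [∅, J1, J2, J3, J4, J5, J6, J7, J8, J9, J10, J11, J12, J13, J14, J15, J16, J17, J18, J19,
    J20, J21, J22, J23, J24, J25, J26, J27, J28, J29, J30, J31, J32, J33, J34, J35, J36, J37,
    J38, J39, J40, J41, J42, J43, J44, J45, J46, J47, J48, J49, J50, J51, J52, J53, J54, J55,
    J56, J57, J58, J59, J60, J61, J62, J63, J64, J65, J66, J67, J68, J69, J70, J71, J72, J73,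
    J74, J75, J76, J77, J78, J79, J80, J81, J82, J83, J84, J85, J86, J87, J88, J89, J90, J91,
    J92].getD n ∅

end

/-- `P` is the vertex set of a Johnson solid `Jn`, that is, of a polyhedron similar to the one
chosen above. -/
def IsJohnsonSolid (n : ℕ) (P : Set Space) : Prop :=
  ∃ (c : ℝ) (f : Space ≃ᵢ Space), 0 < c ∧ P = (fun x => c • f x) '' vertices n

end JohnsonSolids

/-! Whether a straight tunnel leaves a hole is a question about plane shadows. Projected along its
direction, the tunnel is the full preimage of a compact convex set `C`, the shadow of the moved
copy. Let `C` lie in the interior of the shadow of the solid. The interior of the remainder then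
lies over `D \ C`, where `D` is the open convex shadow of the interior of the solid, and its fibres
over this plane region are open intervals. A continuous section together with segments in the fibres
shows that the remainder is connected. If it were simply connected, the projection minus a point of
`C` would have a continuous logarithm on it; pulled back along the section and a star-shaped curve
around `C`, this would give a logarithm on the punctured plane, which does not exist. This is
`isSetWithHole_diff_preimage`, and `hasRupertProperty_of_shadow` turns it into the criterion used:
some shadow of the vertices, after a translation, lies in the interior of another shadow. The
property passes to similar polyhedra by conjugation (`HasRupertProperty.similar`), so one position
and scale per solid suffices.

The criterion has finite certificates: two integral quaternions for the two views, a translation,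
and a cyclic list of vertices. If all shadows of the second view are strictly to the left of all
edges of the polygon in the first view, they are interior to its hull
(`mem_interior_convexHull_of_cross_pos`). The inequalities are strict, so approximate coordinates
are enough: `hasRupertProperty_of_test` reduces the claim to integer interval arithmetic, which the
kernel evaluates.

The classes `Encl`, `BoxMem` and `Covers` derive the boxes around the vertices from the definitions
of the solids. Angles are multiples of `π / 240`, and the other algebraic numbers are located by a
change of sign. Intervals cannot decide equalities, so vertices that are removed or selected by an
equation are treated exactly, with coordinates in the ring `ℤ[φ]`. -/

namespace JohnsonSolids

open Set Topology

/-! ### Plane annuli and shadows -/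

/-- Between a bounded convex neighbourhood `C` of the origin and a larger open convex set `D` there
is a continuous positive radial function whose graph avoids `C` and stays in `D`; moreover the
region between them is connected. -/
theorem exists_radial_and_isConnected_diff {C D : Set ℂ} (hC : Convex ℝ C) (hCc : IsCompact C)
    (h0 : C ∈ 𝓝 0) (hD : Convex ℝ D) (hDo : IsOpen D) (hCD : C ⊆ D) :
    (∃ r : ℂ → ℝ, ContinuousOn r {0}ᶜ ∧ ∀ u ≠ 0, 0 < r u ∧ r u • u ∈ D \ C) ∧
      IsConnected (D \ C) := by
  have hD0 : D ∈ 𝓝 0 := Filter.mem_of_superset h0 hCD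
  have hgC := continuous_gauge hC h0
  have hgD := continuous_gauge hD hD0
  have hpos : ∀ u : ℂ, u ≠ 0 → 0 < gauge C u := fun u hu =>
    (gauge_pos (absorbent_nhds_zero h0) ((NormedSpace.isVonNBounded_iff ℝ).2 hCc.isBounded)).2 hu
  have hmemC : ∀ z, z ∈ C ↔ gauge C z ≤ 1 := fun z => by
    rw [gauge_le_one_iff_mem_closure hC h0, hCc.isClosed.closure_eq]
  have hmemD : ∀ z, z ∈ D ↔ gauge D z < 1 := fun z => by
    rw [gauge_lt_one_iff_mem_interior hD hD0, hDo.interior_eq]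
  -- The multiple of `u` with `C`-gauge one belongs to `C`, hence to the open set `D`, where the
  -- gauge of `D` is less than one.
  have hlt : ∀ u : ℂ, u ≠ 0 → gauge D u < gauge C u := fun u hu => by
    have h := hpos u hu
    have : (gauge C u)⁻¹ • u ∈ C := by
      rw [hmemC, gauge_smul_of_nonneg (inv_nonneg.2 h.le), smul_eq_mul, inv_mul_cancel₀ h.ne']
    have := (hmemD _).1 (hCD this)
    rwa [gauge_smul_of_nonneg (inv_nonneg.2 h.le), smul_eq_mul, inv_mul_lt_iff₀ h, mul_one] at this
  -- The gauges are interpolated, not the radii: `D` may be unbounded, so its gauge may vanish and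
  -- have no reciprocal.
  have key : ∀ u : ℂ, u ≠ 0 → ∀ ρ : ℝ, gauge D u < ρ → ρ < gauge C u → 0 < ρ⁻¹ ∧
      ρ⁻¹ • u ∈ D \ C := fun u hu ρ h1 h2 => by
    have hρ : 0 < ρ := (gauge_nonneg u).trans_lt h1
    have hi := inv_pos.2 hρ
    refine ⟨hi, (hmemD _).2 ?_, fun h => ?_⟩
    · rw [gauge_smul_of_nonneg hi.le, smul_eq_mul, inv_mul_lt_iff₀ hρ, mul_one]
      exact h1
    · rw [hmemC, gauge_smul_of_nonneg hi.le, smul_eq_mul, inv_mul_le_iff₀ hρ, mul_one] at h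
      exact absurd h h2.not_ge
  have hmid : ∀ u : ℂ, u ≠ 0 → ∀ t ∈ Ioo (0 : ℝ) 1,
      gauge D u < t * gauge C u + (1 - t) * gauge D u ∧
      t * gauge C u + (1 - t) * gauge D u < gauge C u := fun u hu t ht => by
    have := hlt u hu
    constructor <;> nlinarith [ht.1, ht.2, mul_pos ht.1 (sub_pos.2 this),
      mul_pos (sub_pos.2 ht.2) (sub_pos.2 this)]
  constructor
  · refine ⟨fun u => (2⁻¹ * gauge C u + (1 - 2⁻¹) * gauge D u)⁻¹, ?_, fun u hu => ?_⟩
    · refine ContinuousOn.inv₀ (by fun_prop) fun u hu => ?_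
      have := hmid u hu 2⁻¹ (by norm_num)
      exact ((gauge_nonneg u).trans_lt this.1).ne'
    · have := hmid u hu 2⁻¹ (by norm_num)
      exact key u hu _ this.1 this.2
  · have hconn : IsConnected (({0}ᶜ : Set ℂ) ×ˢ Ioo (0 : ℝ) 1) :=
      (isConnected_compl_singleton_of_one_lt_rank (by simp) 0).prod
        (isConnected_Ioo one_pos)
    -- A point `z` of the region is its own image for the parameter `t` at which the interpolated
    -- gauge of `z` is one.
    have him : D \ C = (fun p : ℂ × ℝ =>
        (p.2 * gauge C p.1 + (1 - p.2) * gauge D p.1)⁻¹ • p.1) '' (({0}ᶜ : Set ℂ) ×ˢ Ioo (0 : ℝ) 1) := by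
      ext z
      constructor
      · rintro ⟨hzD, hzC⟩
        have hz : z ≠ 0 := fun h => hzC (h ▸ mem_of_mem_nhds h0)
        rw [hmemD] at hzD
        rw [hmemC, not_le] at hzC
        have hd : 0 < gauge C z - gauge D z := by linarith
        refine ⟨(z, (1 - gauge D z) / (gauge C z - gauge D z)), ⟨hz, ?_, ?_⟩, ?_⟩
        · exact div_pos (by linarith) hd
        · rw [div_lt_one hd]; linarith
        · have : (1 - gauge D z) / (gauge C z - gauge D z) * gauge C z +
              (1 - (1 - gauge D z) / (gauge C z - gauge D z)) * gauge D z = 1 := by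
            field_simp
            ring
          simp [this]
      · rintro ⟨⟨u, t⟩, ⟨hu, ht⟩, rfl⟩
        have := hmid u hu t ht
        exact (key u hu _ this.1 this.2).2
    rw [him]
    have hcont : Continuous fun p : ℂ × ℝ => p.2 * gauge C p.1 + (1 - p.2) * gauge D p.1 := by
      fun_prop
    refine hconn.image _ (ContinuousOn.smul (hcont.continuousOn.inv₀ fun p hp => ?_)
      continuous_fst.continuousOn)
    have := hmid p.1 hp.1 p.2 hp.2
    exact ((gauge_nonneg p.1).trans_lt this.1).ne'

/-- There is no continuous logarithm, up to positive factors, on the punctured plane. -/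
theorem not_exists_continuousOn_log (l : ℂ → ℂ) (r : ℂ → ℝ) (hl : ContinuousOn l {0}ᶜ)
    (hr : ∀ u ≠ 0, 0 < r u) (h : ∀ u ≠ 0, Complex.exp (l u) = r u • u) : False := by
  have hconn : IsConnected ({0}ᶜ : Set ℂ) := isConnected_compl_singleton_of_one_lt_rank (by simp) 0
  have hneg : ContinuousOn (fun u => l (-u)) {0}ᶜ :=
    hl.comp continuous_neg.continuousOn fun u hu => by simpa using hu
  -- This function is odd on a connected set, so it has a zero. There `exp (l u)` and `exp (l (-u))`
  -- have the same direction, although they are positive multiples of `u` and `-u`.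
  have hg : ContinuousOn (fun u => (l u).im - (l (-u)).im) {0}ᶜ :=
    (Complex.continuous_im.comp_continuousOn hl).sub (Complex.continuous_im.comp_continuousOn hneg)
  obtain ⟨u, hu, hu0⟩ : ∃ u ∈ ({0}ᶜ : Set ℂ), (l u).im - (l (-u)).im = 0 := by
    rcases le_total ((l 1).im - (l (-1)).im) 0 with h1 | h1
    · obtain ⟨u, hu, h⟩ := hconn.isPreconnected.intermediate_value (a := 1) (b := -1)
        (by simp) (by simp) hg ⟨h1, by simpa using h1⟩
      exact ⟨u, hu, h⟩
    · obtain ⟨u, hu, h⟩ := hconn.isPreconnected.intermediate_value (a := -1) (b := 1)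
        (by simp) (by simp) hg ⟨by simpa using h1, h1⟩
      exact ⟨u, hu, h⟩
  have hu' : -u ≠ 0 := neg_ne_zero.2 hu
  have e1 := h u hu
  have e2 := h (-u) hu'
  have him : (l u).im = (l (-u)).im := by linarith
  have e3 : Complex.exp (l u) =
      (Real.exp ((l u).re - (l (-u)).re) : ℂ) * Complex.exp (l (-u)) := by
    rw [Complex.ofReal_exp, ← Complex.exp_add]
    congr 1
    apply Complex.ext <;> simp [him]
  rw [e1, e2] at e3
  have e4 : ((r u + Real.exp ((l u).re - (l (-u)).re) * r (-u) : ℝ) : ℂ) * u = 0 := by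
    simp only [Complex.real_smul] at e3
    push_cast at e3 ⊢
    linear_combination e3
  have hp : 0 < r u + Real.exp ((l u).re - (l (-u)).re) * r (-u) :=
    add_pos (hr u hu) (mul_pos (Real.exp_pos _) (hr _ hu'))
  rcases mul_eq_zero.1 e4 with h | h
  · exact hp.ne' (by exact_mod_cast h)
  · exact hu h

/-- A convex open set has a continuous section over its shadow. -/
theorem exists_continuous_section {E : Type*} [NormedAddCommGroup E] [NormedSpace ℝ E]
    [FiniteDimensional ℝ E] {O : Set E} (hO : Convex ℝ O) (hOo : IsOpen O) (π : E →L[ℝ] ℂ)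
    (hπ : Function.Surjective π) {v : E} (hv : ∀ x, π x = 0 ↔ ∃ t : ℝ, x = t • v) :
    ∃ s : ℂ → E, ContinuousOn s (π '' O) ∧ ∀ y ∈ π '' O, s y ∈ O ∧ π (s y) = y := by
  obtain ⟨σ, hσ⟩ := (π : E →ₗ[ℝ] ℂ).exists_rightInverse_of_surjective (LinearMap.range_eq_top.2 hπ)
  have hσ' : ∀ y, π (σ y) = y := fun y => LinearMap.congr_fun hσ y
  have hσc : Continuous σ := σ.continuous_of_finiteDimensional
  have hπv : π v = 0 := (hv v).2 ⟨1, (one_smul ℝ v).symm⟩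
  -- The admissible heights over a point form a convex set, and a height admissible at one point
  -- stays so nearby because `O` is open; a partition of unity glues such local constants.
  obtain ⟨g, hg⟩ := exists_continuous_forall_mem_convex_of_local_const (X := π '' O) (E := ℝ)
    (t := fun y => {h : ℝ | σ y.1 + h • v ∈ O})
    (fun y => by
      intro a ha b hb p q hp hq hpq
      have := hO ha hb hp hq hpq
      simp only [mem_ofPred_eq] at this ⊢
      convert this using 1
      have : σ y.1 = p • σ y.1 + q • σ y.1 := by rw [← add_smul, hpq, one_smul]
      nth_rewrite 1 [this]
      simp only [smul_add, add_smul, smul_eq_mul, mul_smul]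
      abel)
    (fun y => by
      obtain ⟨y, x, hx, rfl⟩ := y
      obtain ⟨t, ht⟩ := (hv (x - σ (π x))).1 (by simp [hσ'])
      refine ⟨t, ?_⟩
      have hcont : Continuous fun y : π '' O => σ y.1 + t • v := by fun_prop
      refine hcont.continuousAt.eventually_mem (hOo.mem_nhds ?_)
      simpa [← ht] using hx)
  classical
  refine ⟨fun y => if h : y ∈ π '' O then σ y + g ⟨y, h⟩ • v else 0, ?_, fun y hy => ?_⟩
  · rw [continuousOn_iff_continuous_domRestrict]
    have : Continuous fun y : π '' O => σ y.1 + g y • v := by fun_prop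
    convert this using 2 with y
    rw [domRestrict_apply, dif_pos y.2]
  · simp only [hy, dite_true]
    exact ⟨hg ⟨y, hy⟩, by simp [hσ', hπv]⟩

/-- Drilling a hole through a convex body: if the convex set `C` lies in the interior of the shadow
of `K`, then removing the cylinder over `C` from `K` leaves a set with a hole. -/
theorem isSetWithHole_diff_preimage {K : Set Space} (hK : Convex ℝ K)
    (hKi : (interior K).Nonempty) (π : Space →L[ℝ] ℂ) (hπ : Function.Surjective π) {v : Space}
    (hv : ∀ x, π x = 0 ↔ ∃ t : ℝ, x = t • v) {C : Set ℂ} (hC : Convex ℝ C) (hCc : IsCompact C)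
    (hCi : (interior C).Nonempty) (hCK : C ⊆ interior (π '' K)) :
    IsSetWithHole (K \ π ⁻¹' C) := by
  set O := interior K with hOdef
  have hO : Convex ℝ O := hK.interior
  have hOo : IsOpen O := isOpen_interior
  have hopen : IsOpenMap π := π.isOpenMap hπ
  -- The shadow of `K` lies in the closure of the open convex set `π '' O`, and such a set is the
  -- interior of its closure.
  have hCD : C ⊆ π '' O := by
    refine hCK.trans ?_
    have hD : Convex ℝ (π '' O) := hO.linear_image (π : Space →ₗ[ℝ] ℂ)
    have hDo : IsOpen (π '' O) := hopen _ hOo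
    have h1 : π '' K ⊆ closure (π '' O) := by
      refine (image_mono ?_).trans (image_closure_subset_closure_image π.continuous)
      rw [hOdef, hK.closure_interior_eq_closure_of_nonempty_interior hKi]
      exact subset_closure
    calc interior (π '' K) ⊆ interior (closure (π '' O)) := interior_mono h1
      _ = interior (π '' O) := hD.interior_closure_eq_interior_of_nonempty_interior
          (by rw [hDo.interior_eq]; exact hKi.image _)
      _ = π '' O := hDo.interior_eq
  have hint : interior (K \ π ⁻¹' C) = O \ π ⁻¹' C := by
    rw [sdiff_eq, interior_inter, (hCc.isClosed.preimage π.continuous).isOpen_compl.interior_eq,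
      ← sdiff_eq]
  -- An interior point `c` of `C` is moved to the origin so that gauges apply.
  obtain ⟨c, hc⟩ := hCi
  have hcC : (fun z => z + c) ⁻¹' C ∈ 𝓝 (0 : ℂ) := by
    refine (Continuous.tendsto (by fun_prop : Continuous fun z : ℂ => z + c) 0) ?_
    simpa using mem_interior_iff_mem_nhds.1 hc
  have hconvpre : ∀ {A : Set ℂ}, Convex ℝ A → Convex ℝ ((fun z => z + c) ⁻¹' A) := fun hA => by
    exact hA.translate_preimage_left c
  have hpre : (fun z => z + c) ⁻¹' C = (fun z => z - c) '' C := by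
    ext z
    constructor
    · intro hz
      exact ⟨z + c, hz, by simp⟩
    · rintro ⟨w, hw, rfl⟩
      simpa using hw
  obtain ⟨⟨r, hrc, hr⟩, hconn⟩ := exists_radial_and_isConnected_diff
    (C := (fun z => z + c) ⁻¹' C) (D := (fun z => z + c) ⁻¹' (π '' O)) (hconvpre hC)
    (by rw [hpre]; exact hCc.image (by fun_prop)) hcC (hconvpre (hO.linear_image (π : Space →ₗ[ℝ] ℂ)))
    ((hopen _ hOo).preimage (by fun_prop)) (preimage_mono hCD)
  have hconn' : IsConnected (π '' O \ C) := by
    have := hconn.image (fun z => z + c) (by fun_prop)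
    rwa [← preimage_sdiff, image_preimage_eq _ fun z => ⟨z - c, by simp⟩]
      at this
  obtain ⟨s, hsc, hs⟩ := exists_continuous_section hO hOo π hπ hv
  rw [IsSetWithHole, hint]
  have hUo : IsOpen (O \ π ⁻¹' C) := hOo.sdiff (hCc.isClosed.preimage π.continuous)
  have hsU : ∀ y ∈ π '' O \ C, s y ∈ O \ π ⁻¹' C := fun y hy =>
    ⟨(hs y hy.1).1, by simpa [(hs y hy.1).2] using hy.2⟩
  refine ⟨?_, fun hsc' => ?_⟩
  · have hsA : IsConnected (s '' (π '' O \ C)) := hconn'.image _ (hsc.mono sdiff_subset)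
    have hsub : s '' (π '' O \ C) ⊆ O \ π ⁻¹' C := by
      rintro _ ⟨y, hy, rfl⟩
      exact hsU y hy
    obtain ⟨x0, hx0⟩ := hsA.nonempty
    refine ⟨⟨x0, hsub hx0⟩, isPreconnected_of_forall x0 fun x hx => ?_⟩
    have hx' : π x ∈ π '' O \ C := ⟨⟨x, hx.1, rfl⟩, hx.2⟩
    -- The segment from `x` to the section stays in the fibre of `x`: inside `O` by convexity, and
    -- off the cylinder because its projection is constant.
    refine ⟨s '' (π '' O \ C) ∪ segment ℝ (s (π x)) x, union_subset hsub ?_, Or.inl hx0,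
      Or.inr (right_mem_segment ℝ _ _), ?_⟩
    · intro z hz
      refine ⟨hO.segment_subset (hs _ hx'.1).1 hx.1 hz, ?_⟩
      obtain ⟨a, b, -, -, hab, rfl⟩ := hz
      have : π (a • s (π x) + b • x) = π x := by
        rw [map_add, map_smul, map_smul, (hs _ hx'.1).2, ← add_smul, hab, one_smul]
      simpa only [mem_preimage, this] using hx.2
    · exact IsPreconnected.union (s (π x)) ⟨_, hx', rfl⟩ (left_mem_segment ℝ _ _)
        hsA.isPreconnected (convex_segment _ _).isPreconnected
  -- On a simply connected open set the nowhere vanishing function `π x - c` has a continuous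
  -- logarithm. Over the points `r u • u + c` it becomes a logarithm of `r u • u`.
  · obtain ⟨L, hLc, hL⟩ := Complex.exists_continuousOn_eqOn_exp_comp hsc' hUo
      (g := fun x => π x - c) (by fun_prop) (by
        rintro ⟨x, hx, h⟩
        refine hx.2 ?_
        rw [mem_preimage, sub_eq_zero.1 h]
        exact interior_subset hc)
    have hmaps : ∀ u ≠ 0, r u • u + c ∈ π '' O \ C := fun u hu => (hr u hu).2
    refine not_exists_continuousOn_log (fun u => L (s (r u • u + c))) r ?_ (fun u hu => (hr u hu).1)
      fun u hu => ?_
    · refine hLc.comp (hsc.comp (ContinuousOn.add (hrc.smul continuousOn_id) continuousOn_const)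
        fun u hu => (hmaps u hu).1) fun u hu => hsU _ (hmaps u hu)
    · have := hL (hsU _ (hmaps u hu))
      simp only [Function.comp] at this
      rw [this, (hs _ (hmaps u hu).1).2]
      ring

/-! ### Invariance under similarities -/

theorem IsSetWithHole.image {S : Set Space} (h : IsSetWithHole S) (e : Space ≃ₜ Space) :
    IsSetWithHole (e '' S) := by
  rw [IsSetWithHole, ← e.image_interior]
  refine ⟨h.1.image _ e.continuous.continuousOn, fun hs => h.2 ?_⟩
  rwa [e.isSimplyConnected_image] at hs

theorem HasRupertProperty.similar {V : Set Space} (h : HasRupertProperty V) {c : ℝ} (hc : 0 < c)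
    (f : Space ≃ᵢ Space) : HasRupertProperty ((fun x => c • f x) '' V) := by
  obtain ⟨f₀, v, hv, hole⟩ := h
  let F : Space ≃ᵃⁱ[ℝ] Space := f.toRealAffineIsometryEquiv
  have hF : ∀ x, F x = f x := fun x => rfl
  let g : Space ≃ₜ Space := f.toHomeomorph.trans (Homeomorph.smulOfNeZero c hc.ne')
  have hg : ∀ x, g x = c • f x := fun x => rfl
  let gA : Space →ᵃ[ℝ] Space := c • (F.toAffineEquiv : Space →ᵃ[ℝ] Space)
  have hgA : ∀ x, gA x = c • f x := fun x => rfl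
  have hgimg : ∀ s : Set Space, (fun x => c • f x) '' s = gA '' s := fun s => rfl
  have hdist : ∀ x y, dist (g x) (g y) = c * dist x y := fun x y => by
    rw [hg, hg, dist_smul₀, f.dist_eq, Real.norm_of_nonneg hc.le]
  have hdist' : ∀ x y, c * dist (g.symm x) (g.symm y) = dist x y := fun x y => by
    rw [← hdist, g.apply_symm_apply, g.apply_symm_apply]
  -- Conjugating an isometry by a similarity cancels the ratio `c`, so the result is an isometry; it
  -- moves the image of `V` to the image of the moved copy.
  let f₁ : Space ≃ᵢ Space :=
    { toEquiv := (g.symm.trans (f₀.toHomeomorph.trans g)).toEquiv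
      isometry_toFun := Isometry.of_dist_eq fun x y => by
        change dist (g (f₀ (g.symm x))) (g (f₀ (g.symm y))) = _
        rw [hdist, f₀.dist_eq, hdist'] }
  have hf₁ : ∀ x, f₁ (g x) = g (f₀ x) := fun x => by
    change g (f₀ (g.symm (g x))) = _
    rw [g.symm_apply_apply]
  have himg : f₁ '' (gA '' V) = gA '' (f₀ '' V) := by
    rw [image_image, image_image]
    exact image_congr fun x _ => hf₁ x
  have htr : ∀ q t, gA (q + t • v) = gA q + t • gA.linear v := fun q t => by
    rw [add_comm q, ← vadd_eq_add, AffineMap.map_vadd, vadd_eq_add, map_smul, add_comm]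
  have hgAg : ∀ s : Set Space, gA '' s = g '' s := fun s => rfl
  refine ⟨f₁, gA.linear v, fun h0 => hv ?_, ?_⟩
  · have := htr 0 1
    rw [h0, smul_zero, add_zero, one_smul, zero_add] at this
    exact g.injective this
  · rw [hgimg, himg, ← AffineMap.image_convexHull]
    have ht : tunnel (gA '' (f₀ '' V)) (gA.linear v) = gA '' tunnel (f₀ '' V) v := by
      ext x
      simp only [tunnel, ← AffineMap.image_convexHull, mem_ofPred_eq]
      constructor
      · rintro ⟨t, _, ⟨q, hq, rfl⟩, rfl⟩
        exact ⟨q + t • v, ⟨t, q, hq, rfl⟩, htr q t⟩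
      · rintro ⟨_, ⟨t, q, hq, rfl⟩, rfl⟩
        exact ⟨t, _, ⟨q, hq, rfl⟩, htr q t⟩
    rw [ht, hgAg, hgAg, ← image_sdiff g.injective]
    exact hole.image g

/-! ### Shadows -/

/-- The vertical projection of space to the complex plane. -/
noncomputable def shadow : Space →L[ℝ] ℂ :=
  LinearMap.toContinuousLinearMap
    { toFun := fun x => ⟨x 0, x 1⟩
      map_add' := fun x y => by apply Complex.ext <;> simp
      map_smul' := fun c x => by apply Complex.ext <;> simp }

theorem shadow_re (x : Space) : (shadow x).re = x 0 := rfl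

theorem shadow_im (x : Space) : (shadow x).im = x 1 := rfl

theorem shadow_surjective : Function.Surjective shadow := fun z =>
  ⟨pt z.re z.im 0, by apply Complex.ext <;> simp [shadow_re, shadow_im, pt]⟩

theorem shadow_eq_zero_iff (x : Space) : shadow x = 0 ↔ ∃ t : ℝ, x = t • pt 0 0 1 := by
  constructor
  · intro h
    refine ⟨x 2, ?_⟩
    have h0 : x 0 = 0 := by rw [← shadow_re, h]; rfl
    have h1 : x 1 = 0 := by rw [← shadow_im, h]; rfl
    ext i
    fin_cases i <;> simp [pt, h0, h1]
  · rintro ⟨t, rfl⟩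
    apply Complex.ext <;> simp [shadow_re, shadow_im, pt]

/-- A finite vertex set has Rupert's property as soon as one of its shadows can be placed in the
interior of another one. -/
theorem hasRupertProperty_of_shadow {V : Set Space} (hV : V.Finite)
    (hVi : (interior (convexHull ℝ V)).Nonempty) (F G : Space ≃ₗᵢ[ℝ] Space) (τ : ℂ)
    (h : ∀ x ∈ V, shadow (G x) + τ ∈ interior (convexHull ℝ ((fun x => shadow (F x)) '' V))) :
    HasRupertProperty V := by
  obtain ⟨w, rfl⟩ := shadow_surjective τ
  -- Seen through `π`, the vertical projection after `F`, the copy `F⁻¹ (G x + w)` has the shadow of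
  -- `G x` translated by `τ`.
  let f : Space ≃ᵢ Space :=
    G.toIsometryEquiv.trans ((IsometryEquiv.addRight w).trans F.symm.toIsometryEquiv)
  have hf : ∀ x, f x = F.symm (G x + w) := fun x => rfl
  let π : Space →L[ℝ] ℂ := shadow ∘L (F.toContinuousLinearEquiv : Space →L[ℝ] Space)
  have hπ : ∀ x, π x = shadow (F x) := fun x => rfl
  have hπf : ∀ x, π (f x) = shadow (G x) + shadow w := fun x => by
    rw [hπ, hf, F.apply_symm_apply, map_add]
  have hπs : Function.Surjective π := shadow_surjective.comp F.surjective
  set v := F.symm (pt 0 0 1) with hvdef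
  have hv : ∀ x, π x = 0 ↔ ∃ t : ℝ, x = t • v := fun x => by
    rw [hπ, shadow_eq_zero_iff]
    refine exists_congr fun t => ?_
    rw [hvdef, ← map_smul, LinearIsometryEquiv.eq_symm_apply]
  have hv0 : v ≠ 0 := by
    rw [hvdef, Ne, LinearIsometryEquiv.map_eq_zero_iff]
    intro h0
    have := congrArg (fun x : Space => x 2) h0
    simp [pt] at this
  have hπv : π v = 0 := (hv v).2 ⟨1, (one_smul ℝ v).symm⟩
  set C := convexHull ℝ (π '' (f '' V)) with hC
  have hCeq : C = π '' convexHull ℝ (f '' V) :=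
    ((π : Space →ₗ[ℝ] ℂ).image_convexHull _).symm
  have hfi : (interior (convexHull ℝ (f '' V))).Nonempty := by
    have : convexHull ℝ (f '' V) = f '' convexHull ℝ V :=
      (AffineMap.image_convexHull
        (f.toRealAffineIsometryEquiv.toAffineEquiv : Space →ᵃ[ℝ] Space) V).symm
    rw [this]
    have := f.toHomeomorph.image_interior (convexHull ℝ V)
    rw [IsometryEquiv.coe_toHomeomorph] at this
    rw [← this]
    exact hVi.image _
  have hCi : (interior C).Nonempty := by
    rw [hCeq]
    exact (hfi.image π).mono ((π.isOpenMap hπs).image_interior_subset _)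
  -- Points with the same projection differ by a multiple of `v`, so the tunnel is exactly the
  -- cylinder over the shadow.
  have ht : tunnel (f '' V) v = π ⁻¹' C := by
    ext x
    simp only [tunnel, mem_ofPred_eq, mem_preimage, hCeq]
    constructor
    · rintro ⟨t, q, hq, rfl⟩
      exact ⟨q, hq, by simp [hπv]⟩
    · rintro ⟨q, hq, hqx⟩
      obtain ⟨t, ht⟩ := (hv (x - q)).1 (by rw [map_sub, hqx, sub_self])
      exact ⟨t, q, hq, by rw [← ht]; abel⟩
  refine ⟨f, v, hv0, ?_⟩
  rw [ht]
  refine isSetWithHole_diff_preimage (convex_convexHull ℝ V) hVi π hπs hv (convex_convexHull ℝ _)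
    (((hV.image f).image π).isCompact_convexHull (𝕜 := ℝ)) hCi ?_
  have hπV : π '' convexHull ℝ V = convexHull ℝ ((fun x => shadow (F x)) '' V) :=
    (π : Space →ₗ[ℝ] ℂ).image_convexHull _
  rw [hπV]
  refine convexHull_min ?_ (convex_convexHull ℝ _).interior
  rintro _ ⟨_, ⟨x, hx, rfl⟩, rfl⟩
  rw [hπf]
  exact h x hx

/-! ### Points inside polygons -/

/-- The cross product of two plane vectors. -/
def cross (z w : ℂ) : ℝ := z.re * w.im - z.im * w.re

/-- If, seen from `p`, every point of the finite set `S` has another one of `S` to its left, then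
`p` lies in the convex hull of `S`. -/
theorem mem_convexHull_of_cross_pos {S : Set ℂ} (hS : S.Finite) (hne : S.Nonempty) {p : ℂ}
    (h : ∀ w ∈ S, ∃ w' ∈ S, 0 < cross (w - p) (w' - p)) : p ∈ convexHull ℝ S := by
  by_contra hp
  obtain ⟨f, u, hfp, hfS⟩ := geometric_hahn_banach_point_closed (convex_convexHull ℝ S)
    (hS.isCompact_convexHull (𝕜 := ℝ)).isClosed hp
  have hpos : ∀ w ∈ S, 0 < f (w - p) := fun w hw => by
    rw [map_sub]
    linarith [hfS w (subset_convexHull ℝ S hw)]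
  have hf : ∀ z : ℂ, f z = z.re * f 1 + z.im * f Complex.I := fun z => by
    conv_lhs => rw [show z = z.re • (1 : ℂ) + z.im • Complex.I by
      apply Complex.ext <;> simp]
    rw [map_add, map_smul, map_smul, smul_eq_mul, smul_eq_mul]
  -- If `p` were separated from `S`, all of `S` would lie in an open half-plane seen from `p`. Here
  -- `k w` is the tangent of the angle from the gradient of `f` to `w - p`; where it is largest, no
  -- point of `S` is further to the left.
  let k : ℂ → ℝ := fun w => ((w - p).im * f 1 - (w - p).re * f Complex.I) / f (w - p)
  obtain ⟨w, hw, hmax⟩ := Set.exists_max_image S k hS hne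
  obtain ⟨w', hw', hc⟩ := h w hw
  have hle := hmax w' hw'
  have h1 := hpos w hw
  have h2 := hpos w' hw'
  have hsq : 0 < f 1 ^ 2 + f Complex.I ^ 2 := by
    rw [hf] at h1
    by_contra hcon
    have e1 : f 1 = 0 := by nlinarith [sq_nonneg (f 1), sq_nonneg (f Complex.I)]
    have e2 : f Complex.I = 0 := by nlinarith [sq_nonneg (f 1), sq_nonneg (f Complex.I)]
    rw [e1, e2] at h1
    simp at h1
  simp only [k] at hle
  rw [div_le_div_iff₀ h2 h1, hf (w - p), hf (w' - p)] at hle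
  have := mul_pos hsq hc
  unfold cross at this
  -- With `n` the gradient of `f`, the identity behind this is `|n|² (z × w) = (n · z) (n × w) - (n
  -- × z) (n · w)`.
  nlinarith

/-- Finitely many strict inequalities, fixed in advance by the list `E`, persist for all points near
`p`, and each of these is in the hull by the previous lemma. The polygon need not be shown to be
convex. -/
theorem mem_interior_convexHull_of_cross_pos {S : Set ℂ} (hS : S.Finite) (hne : S.Nonempty)
    (E : List (ℂ × ℂ)) (hE : ∀ w ∈ S, ∃ w' ∈ S, (w, w') ∈ E) {p : ℂ}
    (h : ∀ e ∈ E, 0 < cross (e.1 - p) (e.2 - p)) : p ∈ interior (convexHull ℝ S) := by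
  have hopen : IsOpen {q : ℂ | ∀ e ∈ E, 0 < cross (e.1 - q) (e.2 - q)} := by
    have : {q : ℂ | ∀ e ∈ E, 0 < cross (e.1 - q) (e.2 - q)} =
        ⋂ e ∈ {e | e ∈ E}, {q : ℂ | 0 < cross (e.1 - q) (e.2 - q)} := by
      ext q
      simp
    rw [this]
    refine (List.finite_toSet E).isOpen_biInter fun e _ => ?_
    refine isOpen_lt continuous_const ?_
    unfold cross
    fun_prop
  refine mem_interior.2 ⟨_, fun q hq => ?_, hopen, h⟩
  refine mem_convexHull_of_cross_pos hS hne fun w hw => ?_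
  obtain ⟨w', hw', he⟩ := hE w hw
  exact ⟨w', hw', hq _ he⟩

/-! ### Rotations from quaternions -/

/-- The coordinates of the rotation belonging to the quaternion `(a, b, c, d)`, multiplied by the
squared norm of the quaternion. -/
def quatRows {R : Type*} [CommRing R] (a b c d : R) (x y z : R) : R × R × R :=
  ((a * a + b * b - c * c - d * d) * x + 2 * (b * c - a * d) * y + 2 * (b * d + a * c) * z,
    2 * (b * c + a * d) * x + (a * a - b * b + c * c - d * d) * y + 2 * (c * d - a * b) * z,
    2 * (b * d - a * c) * x + 2 * (c * d + a * b) * y + (a * a - b * b - c * c + d * d) * z)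

/-- The rotation of space belonging to a nonzero quaternion. -/
theorem exists_rotation (a b c d : ℝ) (h : 0 < a * a + b * b + c * c + d * d) :
    ∃ F : Space ≃ₗᵢ[ℝ] Space, ∀ x : Space,
      (a * a + b * b + c * c + d * d) * F x 0 = (quatRows a b c d (x 0) (x 1) (x 2)).1 ∧
      (a * a + b * b + c * c + d * d) * F x 1 = (quatRows a b c d (x 0) (x 1) (x 2)).2.1 := by
  set N := a * a + b * b + c * c + d * d with hN
  let L : Space →ₗ[ℝ] Space :=
    { toFun := fun x => pt ((quatRows a b c d (x 0) (x 1) (x 2)).1 / N)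
        ((quatRows a b c d (x 0) (x 1) (x 2)).2.1 / N) ((quatRows a b c d (x 0) (x 1) (x 2)).2.2 / N)
      map_add' := fun x y => by
        ext i
        fin_cases i <;> simp [pt, quatRows] <;> ring
      map_smul' := fun r x => by
        ext i
        fin_cases i <;> simp [pt, quatRows] <;> ring }
  have hL : ∀ x, ‖L x‖ = ‖x‖ := fun x => by
    rw [EuclideanSpace.norm_eq, EuclideanSpace.norm_eq]
    congr 1
    simp only [Fin.sum_univ_three, Real.norm_eq_abs, sq_abs, L, LinearMap.coe_mk, AddHom.coe_mk, pt]
    simp only [quatRows]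
    simp
    field_simp
    rw [hN]
    ring
  -- A norm-preserving linear map between spaces of the same finite dimension is onto; `rfl` is the
  -- equality of dimensions.
  let F := LinearIsometry.toLinearIsometryEquiv (⟨L, hL⟩ : Space →ₗᵢ[ℝ] Space) rfl
  have hF : ∀ x, F x = L x := fun x => rfl
  refine ⟨F, fun x => ?_⟩
  rw [hF]
  constructor <;> simp [L, pt] <;> field_simp

/-! ### Interval arithmetic with fixed denominators -/

/-- An interval of reals with end points `lo / 10 ^ 15` and `hi / 10 ^ 15`; the interval carries
information only if `ok` is `true`. -/
structure Ival where
  ok : Bool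
  lo : ℤ
  hi : ℤ

namespace Ival

/-- The common denominator of all end points. -/
def scale : ℤ := 1000000000000000

/-- The smallest of four integers. -/
def min4 (a b c d : ℤ) : ℤ := min (min a b) (min c d)

/-- The largest of four integers. -/
def max4 (a b c d : ℤ) : ℤ := max (max a b) (max c d)

/-- An enclosure of the rational number `p / q`. -/
def ofRat (p : ℤ) (q : ℕ) : Ival := ⟨decide (0 < q), p * scale / q, p * scale / q + 1⟩

/-- The integer `n` as an interval. -/
def ofInt (n : ℤ) : Ival := ⟨true, n * scale, n * scale⟩

/-- Sums of intervals. -/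
def add (a b : Ival) : Ival := ⟨a.ok && b.ok, a.lo + b.lo, a.hi + b.hi⟩

/-- Negatives of intervals. -/
def neg (a : Ival) : Ival := ⟨a.ok, -a.hi, -a.lo⟩

/-- Differences of intervals. -/
def sub (a b : Ival) : Ival := ⟨a.ok && b.ok, a.lo - b.hi, a.hi - b.lo⟩

/-- Integer multiples of intervals. -/
def smul (k : ℤ) (a : Ival) : Ival :=
  if 0 ≤ k then ⟨a.ok, k * a.lo, k * a.hi⟩ else ⟨a.ok, k * a.hi, k * a.lo⟩

/-- Products of intervals. -/
def mul (a b : Ival) : Ival :=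
  ⟨a.ok && b.ok,
    min4 (a.lo * b.lo) (a.lo * b.hi) (a.hi * b.lo) (a.hi * b.hi) / scale,
    max4 (a.lo * b.lo) (a.lo * b.hi) (a.hi * b.lo) (a.hi * b.hi) / scale + 1⟩

/-- Inverses of positive intervals. -/
def inv (a : Ival) : Ival :=
  ⟨a.ok && decide (0 < a.lo), scale * scale / a.hi, scale * scale / a.lo + 1⟩

/-- Newton's iteration for the square root. -/
def newton (n : ℕ) : ℕ → ℕ → ℕ
  | 0, r => r
  | k + 1, r => newton n k ((r + n / r) / 2)

/-- A guess for the square root of a natural number, rounded down. -/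
def sqrtGuess (n : ℕ) : ℕ :=
  let r := newton n 8 (2 ^ (Nat.log2 n / 2 + 1))
  if r * r ≤ n then r else r - 1

/-- Square roots of intervals. -/
def sqrt (a : Ival) : Ival :=
  let l := a.lo.toNat * scale.toNat
  let h := a.hi.toNat * scale.toNat
  let p := sqrtGuess l
  let q := sqrtGuess h + 1
  ⟨a.ok && decide (p * p ≤ l) && decide (h ≤ q * q), p, q⟩

end Ival

/-- The interval `a` encloses the real number `x`. -/
class Encl (x : ℝ) (a : outParam Ival) : Prop where
  mem : a.ok = true → (a.lo : ℝ) ≤ x * (Ival.scale : ℝ) ∧ x * (Ival.scale : ℝ) ≤ a.hi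

namespace Encl

theorem scale_pos : (0 : ℝ) < (Ival.scale : ℝ) := by norm_num [Ival.scale]

/-- Integer division by a positive number rounds down, so the quotient is a safe lower end point;
one more than the quotient is a safe upper one. -/
theorem le_of_ediv {m n : ℤ} {x : ℝ} (hn : (0 : ℝ) < n) (h : (m : ℝ) ≤ x * n) :
    ((m / n : ℤ) : ℝ) ≤ x := by
  have hn' : 0 < n := by exact_mod_cast hn
  have h1 : m / n * n ≤ m := Int.ediv_mul_le m hn'.ne'
  have h2 : ((m / n : ℤ) : ℝ) * n ≤ m := by exact_mod_cast h1
  exact le_of_mul_le_mul_right (h2.trans h) hn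

theorem le_ediv_add_one {m n : ℤ} {x : ℝ} (hn : (0 : ℝ) < n) (h : x * n ≤ m) :
    x ≤ ((m / n + 1 : ℤ) : ℝ) := by
  have hn' : 0 < n := by exact_mod_cast hn
  have h1 : m < (m / n + 1) * n := Int.lt_ediv_add_one_mul_self m hn'
  have h2 : (m : ℝ) < ((m / n + 1 : ℤ) : ℝ) * n := by exact_mod_cast h1
  exact (lt_of_mul_lt_mul_right (h.trans_lt h2) hn.le).le

theorem ofInt (n : ℤ) : Encl n (Ival.ofInt n) :=
  ⟨fun _ => by simp [Ival.ofInt]⟩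

theorem ofRat (p : ℤ) (q : ℕ) : Encl (p / q) (Ival.ofRat p q) :=
  ⟨fun h => by
    have hq : (0 : ℝ) < ((q : ℤ) : ℝ) := by
      have : 0 < q := by simpa [Ival.ofRat] using h
      exact_mod_cast this
    have e : (p : ℝ) / q * Ival.scale * ((q : ℤ) : ℝ) = ((p * Ival.scale : ℤ) : ℝ) := by
      push_cast at hq ⊢
      field_simp
    exact ⟨le_of_ediv hq e.ge, le_ediv_add_one hq e.le⟩⟩

instance zero : Encl 0 (Ival.ofInt 0) := by simpa using ofInt 0

instance one : Encl 1 (Ival.ofInt 1) := by simpa using ofInt 1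

instance ofNat (n : ℕ) [n.AtLeastTwo] : Encl (ofNat(n) : ℝ) (Ival.ofInt n) := by
  have := ofInt (n : ℤ)
  rwa [Int.cast_natCast] at this

variable {x y : ℝ} {a b : Ival}

/-- Since the interval is an output parameter, class resolution computes it from the expression for
the number. Side conditions, such as the positivity of a denominator, are recorded in `ok` and
checked only in the final evaluation, so the instances need no hypotheses about them. -/
instance add [ha : Encl x a] [hb : Encl y b] : Encl (x + y) (Ival.add a b) :=
  ⟨fun h => by
    simp only [Ival.add, Bool.and_eq_true] at h
    have h1 := ha.mem h.1
    have h2 := hb.mem h.2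
    simp only [Ival.add, Int.cast_add, add_mul]
    exact ⟨add_le_add h1.1 h2.1, add_le_add h1.2 h2.2⟩⟩

instance neg [ha : Encl x a] : Encl (-x) (Ival.neg a) :=
  ⟨fun h => by
    have h1 := ha.mem h
    simp only [Ival.neg, Int.cast_neg, neg_mul]
    exact ⟨neg_le_neg h1.2, neg_le_neg h1.1⟩⟩

instance sub [ha : Encl x a] [hb : Encl y b] : Encl (x - y) (Ival.sub a b) :=
  ⟨fun h => by
    simp only [Ival.sub, Bool.and_eq_true] at h
    have h1 := ha.mem h.1
    have h2 := hb.mem h.2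
    simp only [Ival.sub, Int.cast_sub, sub_mul]
    exact ⟨sub_le_sub h1.1 h2.2, sub_le_sub h1.2 h2.1⟩⟩

theorem smul (k : ℤ) (ha : Encl x a) : Encl (k * x) (Ival.smul k a) :=
  ⟨fun h => by
    unfold Ival.smul at h ⊢
    rw [mul_assoc]
    split_ifs at h ⊢ with hk
    · have h1 := ha.mem h
      have hk' : (0 : ℝ) ≤ k := by exact_mod_cast hk
      push_cast
      exact ⟨mul_le_mul_of_nonneg_left h1.1 hk', mul_le_mul_of_nonneg_left h1.2 hk'⟩
    · have h1 := ha.mem h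
      have hk' : (k : ℝ) ≤ 0 := by exact_mod_cast (not_le.1 hk).le
      push_cast
      exact ⟨mul_le_mul_of_nonpos_left h1.2 hk', mul_le_mul_of_nonpos_left h1.1 hk'⟩⟩

/-- A product lies between the smallest and the largest product of end points. -/
theorem mul_mem_minmax {a b c d : ℤ} {x y : ℝ} (hx : (a : ℝ) ≤ x ∧ x ≤ b)
    (hy : (c : ℝ) ≤ y ∧ y ≤ d) :
    (Ival.min4 (a * c) (a * d) (b * c) (b * d) : ℝ) ≤ x * y ∧
      x * y ≤ (Ival.max4 (a * c) (a * d) (b * c) (b * d) : ℝ) := by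
  -- The product is linear in each factor separately, so its extremes over a rectangle occur at
  -- corners.
  have h1 : ∀ z : ℝ, min (a * z) (b * z) ≤ x * z ∧ x * z ≤ max (a * z) (b * z) := fun z => by
    rcases le_total 0 z with hz | hz
    · exact ⟨min_le_of_left_le (mul_le_mul_of_nonneg_right hx.1 hz),
        le_max_of_le_right (mul_le_mul_of_nonneg_right hx.2 hz)⟩
    · exact ⟨min_le_of_right_le (mul_le_mul_of_nonpos_right hx.2 hz),
        le_max_of_le_left (mul_le_mul_of_nonpos_right hx.1 hz)⟩
  have h2 : min (x * c) (x * d) ≤ x * y ∧ x * y ≤ max (x * c) (x * d) := by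
    rcases le_total 0 x with hz | hz
    · exact ⟨min_le_of_left_le (mul_le_mul_of_nonneg_left hy.1 hz),
        le_max_of_le_right (mul_le_mul_of_nonneg_left hy.2 hz)⟩
    · exact ⟨min_le_of_right_le (mul_le_mul_of_nonpos_left hy.2 hz),
        le_max_of_le_left (mul_le_mul_of_nonpos_left hy.1 hz)⟩
  have hc := h1 c
  have hd := h1 d
  simp only [Ival.min4, Ival.max4]
  push_cast
  constructor
  · refine le_trans ?_ h2.1
    refine le_min (le_trans ?_ hc.1) (le_trans ?_ hd.1)
    · exact le_min ((min_le_left _ _).trans (min_le_left _ _))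
        ((min_le_right _ _).trans (min_le_left _ _))
    · exact le_min ((min_le_left _ _).trans (min_le_right _ _))
        ((min_le_right _ _).trans (min_le_right _ _))
  · refine h2.2.trans ?_
    refine max_le (hc.2.trans ?_) (hd.2.trans ?_)
    · exact max_le ((le_max_left _ _).trans (le_max_left _ _))
        ((le_max_left _ _).trans (le_max_right _ _))
    · exact max_le ((le_max_right _ _).trans (le_max_left _ _))
        ((le_max_right _ _).trans (le_max_right _ _))

instance mul [ha : Encl x a] [hb : Encl y b] : Encl (x * y) (Ival.mul a b) :=
  ⟨fun h => by
    simp only [Ival.mul, Bool.and_eq_true] at h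
    have := mul_mem_minmax (ha.mem h.1) (hb.mem h.2)
    have e : x * Ival.scale * (y * Ival.scale) = x * y * Ival.scale * Ival.scale := by ring
    rw [e] at this
    exact ⟨le_of_ediv scale_pos this.1, le_ediv_add_one scale_pos this.2⟩⟩

instance inv [ha : Encl x a] : Encl x⁻¹ (Ival.inv a) :=
  ⟨fun h => by
    simp only [Ival.inv, Bool.and_eq_true, decide_eq_true_eq] at h
    have h1 := ha.mem h.1
    have hlo : (0 : ℝ) < a.lo := by exact_mod_cast h.2
    have hs := scale_pos
    have hxs := hlo.trans_le h1.1
    have hx : 0 < x := pos_of_mul_pos_left hxs hs.le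
    have hhi : (0 : ℝ) < a.hi := hxs.trans_le h1.2
    have e : x⁻¹ * Ival.scale * (x * Ival.scale) = Ival.scale * Ival.scale := by
      field_simp
    have hp : 0 ≤ x⁻¹ * Ival.scale := by positivity
    refine ⟨le_of_ediv hhi ?_, le_ediv_add_one hlo ?_⟩
    · push_cast
      rw [← e]
      exact mul_le_mul_of_nonneg_left h1.2 hp
    · push_cast
      rw [← e]
      exact mul_le_mul_of_nonneg_left h1.1 hp⟩

instance div [ha : Encl x a] [hb : Encl y b] : Encl (x / y) (Ival.mul a (Ival.inv b)) := by
  rw [div_eq_mul_inv]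
  infer_instance

instance sq [ha : Encl x a] : Encl (x ^ 2) (Ival.mul a a) := by
  rw [_root_.sq]
  infer_instance

instance cube [ha : Encl x a] : Encl (x ^ 3) (Ival.mul (Ival.mul a a) a) := by
  rw [pow_succ, _root_.sq]
  infer_instance

instance pow_four [ha : Encl x a] : Encl (x ^ 4) (Ival.mul (Ival.mul a a) (Ival.mul a a)) := by
  rw [show x ^ 4 = x * x * (x * x) by ring]
  infer_instance

theorem toNat_le {m : ℤ} {z : ℝ} (h : (m : ℝ) ≤ z) (hz : 0 ≤ z) : ((m.toNat : ℕ) : ℝ) ≤ z := by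
  rcases le_total 0 m with hm | hm
  · have : ((m.toNat : ℕ) : ℝ) = ((m.toNat : ℤ) : ℝ) := by norm_cast
    rwa [this, Int.toNat_of_nonneg hm]
  · simpa [Int.toNat_of_nonpos hm] using hz

theorem le_toNat {m : ℤ} {z : ℝ} (h : z ≤ m) : z ≤ ((m.toNat : ℕ) : ℝ) := by
  refine h.trans ?_
  have : ((m.toNat : ℕ) : ℝ) = ((m.toNat : ℤ) : ℝ) := by norm_cast
  rw [this]
  exact_mod_cast Int.self_le_toNat m

/-- Nothing about Newton's iteration is used: its results are generalized away, and only the two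
checks `p * p ≤ l` and `h ≤ q * q` matter. For a negative radicand the root is `0` by convention,
and the lower end point is then forced to be `0`. -/
instance sqrt [ha : Encl x a] : Encl √x (Ival.sqrt a) :=
  ⟨fun h => by
    simp only [Ival.sqrt, Bool.and_eq_true, decide_eq_true_eq] at h ⊢
    obtain ⟨⟨hok, hl⟩, hh⟩ := h
    generalize Ival.sqrtGuess (a.lo.toNat * Ival.scale.toNat) = p at hl ⊢
    generalize Ival.sqrtGuess (a.hi.toNat * Ival.scale.toNat) + 1 = q at hh ⊢
    have h1 := ha.mem hok
    have hs := scale_pos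
    have hsn : ((Ival.scale.toNat : ℕ) : ℝ) = Ival.scale := by
      have : Ival.scale.toNat = 1000000000000000 := rfl
      rw [this]
      norm_num [Ival.scale]
    have hl' : ((p : ℝ)) * p ≤ (a.lo.toNat : ℝ) * Ival.scale := by
      rw [← hsn]; exact_mod_cast hl
    have hh' : (a.hi.toNat : ℝ) * Ival.scale ≤ (q : ℝ) * q := by
      rw [← hsn]; exact_mod_cast hh
    have hq0 : (0 : ℝ) ≤ q := Nat.cast_nonneg _
    have hp0 : (0 : ℝ) ≤ p := Nat.cast_nonneg _
    have hup := mul_le_mul_of_nonneg_right (le_toNat h1.2) hs.le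
    push_cast
    constructor
    · rcases le_total 0 x with hx | hx
      · have hlo := mul_le_mul_of_nonneg_right (toNat_le h1.1 (by positivity)) hs.le
        refine abs_le_of_sq_le_sq' ?_ (by positivity) |>.2
        rw [mul_pow, Real.sq_sqrt hx]
        nlinarith
      · have hz : a.lo ≤ 0 := by
          have : (a.lo : ℝ) ≤ 0 := h1.1.trans (mul_nonpos_of_nonpos_of_nonneg hx hs.le)
          exact_mod_cast this
        rw [Int.toNat_of_nonpos hz] at hl'
        have : (p : ℝ) = 0 := by
          norm_num at hl'
          nlinarith
        rw [this]
        positivity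
    · rcases le_total 0 x with hx | hx
      · refine abs_le_of_sq_le_sq' ?_ hq0 |>.2
        rw [mul_pow, Real.sq_sqrt hx]
        nlinarith
      · rw [Real.sqrt_eq_zero_of_nonpos hx, zero_mul]
        exact hq0⟩

/-- Passing to a larger interval. -/
theorem mono (ha : Encl x a) (h : (a.ok && decide (b.lo ≤ a.lo) && decide (a.hi ≤ b.hi)) = true) :
    Encl x b :=
  ⟨fun _ => by
    simp only [Bool.and_eq_true, decide_eq_true_eq] at h
    have h1 := ha.mem h.1.1
    exact ⟨le_trans (by exact_mod_cast h.1.2) h1.1, h1.2.trans (by exact_mod_cast h.2)⟩⟩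

end Encl

/-! ### Trigonometric functions of multiples of `π / 240` -/

/-- A rectangle in the complex plane. -/
abbrev Rect : Type := Ival × Ival

namespace Rect

/-- Products of rectangles, as complex numbers. -/
def mul (a b : Rect) : Rect :=
  (Ival.sub (Ival.mul a.1 b.1) (Ival.mul a.2 b.2), Ival.add (Ival.mul a.1 b.2) (Ival.mul a.2 b.1))

/-- Complex conjugation of rectangles. -/
def conj (a : Rect) : Rect := (a.1, Ival.neg a.2)

/-- Powers of rectangles by repeated squaring, with bounded recursion depth. -/
def pow : ℕ → Rect → ℕ → Rect
  | 0, _, _ => (⟨false, 0, 0⟩, ⟨false, 0, 0⟩)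
  | f + 1, a, k => bif k.beq 0 then (Ival.ofInt 1, Ival.ofInt 0) else
      let b := pow f (mul a a) (k / 2)
      bif (k % 2).beq 0 then b else mul b a

end Rect

/-- The rectangle `a` encloses the point at polar coordinates `r` and `θ`. -/
def EnclPolar (r θ : ℝ) (a : Rect) : Prop := Encl (r * Real.cos θ) a.1 ∧ Encl (r * Real.sin θ) a.2

namespace EnclPolar

variable {r s θ η : ℝ} {a b : Rect}

theorem of_eq {c d : ℝ} {a b : Ival} (hc : Real.cos θ = c) (hd : Real.sin θ = d) [Encl c a]
    [Encl d b] : EnclPolar 1 θ (a, b) := by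
  subst hc hd
  exact ⟨by rwa [one_mul], by rwa [one_mul]⟩

theorem mul (ha : EnclPolar r θ a) (hb : EnclPolar s η b) :
    EnclPolar (r * s) (θ + η) (Rect.mul a b) := by
  obtain ⟨h1, h2⟩ := ha
  obtain ⟨h3, h4⟩ := hb
  constructor
  · rw [show r * s * Real.cos (θ + η) = r * Real.cos θ * (s * Real.cos η) -
      r * Real.sin θ * (s * Real.sin η) by rw [Real.cos_add]; ring]
    infer_instance
  · rw [show r * s * Real.sin (θ + η) = r * Real.cos θ * (s * Real.sin η) +
      r * Real.sin θ * (s * Real.cos η) by rw [Real.sin_add]; ring]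
    infer_instance

theorem conj (ha : EnclPolar r θ a) : EnclPolar r (-θ) (Rect.conj a) := by
  obtain ⟨h1, h2⟩ := ha
  constructor
  · rw [Real.cos_neg]
    exact h1
  · rw [Real.sin_neg, mul_neg]
    exact Encl.neg

theorem pow (f : ℕ) : ∀ {θ : ℝ} {a : Rect} (_ : EnclPolar 1 θ a) (k : ℕ),
    EnclPolar 1 (k * θ) (Rect.pow f a k) := by
  induction f with
  -- When the recursion depth is exhausted the result is flagged as uninformative, so no bound on
  -- `k` is needed.
  | zero => exact fun _ _ => ⟨⟨fun h => by simp [Rect.pow] at h⟩, ⟨fun h => by simp [Rect.pow] at h⟩⟩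
  | succ f ih =>
    intro θ a ha k
    rw [Rect.pow]
    by_cases hk : k = 0
    · subst hk
      simp only [Nat.beq_refl, cond_true, Nat.cast_zero, zero_mul]
      constructor
      · simpa using Encl.one
      · simpa using Encl.zero
    · have h0 : k.beq 0 = false := by
        cases k with
        | zero => exact absurd rfl hk
        | succ k => rfl
      rw [h0, cond_false]
      have hsq := ha.mul ha
      rw [one_mul] at hsq
      have hb := ih hsq (k / 2)
      have hk2 : 2 * (k / 2) + k % 2 = k := Nat.div_add_mod k 2
      rcases Nat.mod_two_eq_zero_or_one k with h | h
      · rw [h] at hk2 ⊢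
        simp only [Nat.beq_refl, cond_true]
        convert hb using 1
        nth_rewrite 1 [← hk2]
        push_cast
        ring
      · rw [h] at hk2 ⊢
        have h1 : Nat.beq 1 0 = false := rfl
        rw [h1, cond_false]
        have := hb.mul ha
        rw [one_mul] at this
        convert this using 1
        nth_rewrite 1 [← hk2]
        push_cast
        ring

end EnclPolar

/-- The point `(cos (π / 240), sin (π / 240))`. -/
def cisUnit : Rect :=
  (⟨true, 999914327573980, 999914327574040⟩, ⟨true, 13089595571310, 13089595571370⟩)

/-- The angle is `2 π / 5 - π / 3 - π / 16`, and cosine and sine of `π / 5`, `π / 3` and `π / 16`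
are explicit radicals. -/
theorem enclPolar_cisUnit : EnclPolar 1 (Real.pi / 240) cisUnit := by
  have hs : Real.sin (Real.pi / 5) = √(1 - ((1 + √5) / 4) ^ 2) := by
    rw [← Real.cos_pi_div_five, Real.sin_eq_sqrt_one_sub_cos_sq (by positivity)
      (by linarith [Real.pi_pos])]
  have h5 := EnclPolar.of_eq Real.cos_pi_div_five hs
  have h3 := EnclPolar.of_eq Real.cos_pi_div_three Real.sin_pi_div_three
  have h16 := EnclPolar.of_eq Real.cos_pi_div_sixteen Real.sin_pi_div_sixteen
  have h := (((h5.mul h5).mul h3.conj).mul h16.conj)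
  rw [show (1 : ℝ) * 1 * 1 * 1 = 1 by norm_num,
    show Real.pi / 5 + Real.pi / 5 + -(Real.pi / 3) + -(Real.pi / 16) = Real.pi / 240 by ring] at h
  exact ⟨h.1.mono (by decide +kernel), h.2.mono (by decide +kernel)⟩

/-! ### Boxes around finitely many points -/

/-- A box in space. -/
abbrev Box : Type := Ival × Ival × Ival

/-- The box `B` contains the point `x`. -/
class BoxMem (x : Space) (B : outParam Box) : Prop where
  encl₀ : Encl (x 0) B.1
  encl₁ : Encl (x 1) B.2.1
  encl₂ : Encl (x 2) B.2.2

instance boxMem_pt {x y z : ℝ} {a b c : Ival} [hx : Encl x a] [hy : Encl y b] [hz : Encl z c] :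
    BoxMem (pt x y z) (a, b, c) := ⟨hx, hy, hz⟩

/-- The boxes in `L` cover the finite set `V`, and each of them meets `V`. -/
class Covers (V : Set Space) (L : outParam (List Box)) : Prop where
  finite : V.Finite
  exists_box : ∀ x ∈ V, ∃ B ∈ L, BoxMem x B
  exists_mem : ∀ B ∈ L, ∃ x ∈ V, BoxMem x B

namespace Covers

instance empty : Covers ∅ [] := ⟨finite_empty, by simp, by simp⟩

instance insert {V : Set Space} {L : List Box} [h : Covers V L] {p : Space} {B : Box}
    [hp : BoxMem p B] : Covers (insert p V) (B :: L) :=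
  ⟨h.finite.insert p,
    fun x hx => by
      rcases hx with rfl | hx
      · exact ⟨B, List.mem_cons_self, hp⟩
      · obtain ⟨B', hB', hx'⟩ := h.exists_box x hx
        exact ⟨B', List.mem_cons_of_mem _ hB', hx'⟩,
    fun B' hB' => by
      rcases List.mem_cons.1 hB' with rfl | hB'
      · exact ⟨p, mem_insert p V, hp⟩
      · obtain ⟨x, hx, hx'⟩ := h.exists_mem B' hB'
        exact ⟨x, mem_insert_of_mem p hx, hx'⟩⟩

instance singleton {p : Space} {B : Box} [hp : BoxMem p B] : Covers {p} [B] := by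
  rw [← insert_empty_eq]
  exact insert

instance union {V W : Set Space} {L M : List Box} [hV : Covers V L] [hW : Covers W M] :
    Covers (V ∪ W) (L ++ M) :=
  ⟨hV.finite.union hW.finite,
    fun x hx => by
      rcases hx with hx | hx
      · obtain ⟨B, hB, h⟩ := hV.exists_box x hx
        exact ⟨B, List.mem_append_left _ hB, h⟩
      · obtain ⟨B, hB, h⟩ := hW.exists_box x hx
        exact ⟨B, List.mem_append_right _ hB, h⟩,
    fun B hB => by
      rcases List.mem_append.1 hB with hB | hB
      · obtain ⟨x, hx, h⟩ := hV.exists_mem B hB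
        exact ⟨x, Or.inl hx, h⟩
      · obtain ⟨x, hx, h⟩ := hW.exists_mem B hB
        exact ⟨x, Or.inr hx, h⟩⟩

theorem image {V : Set Space} {L : List Box} (h : Covers V L) {f : Space → Space} {g : Box → Box}
    (hfg : ∀ x B, BoxMem x B → BoxMem (f x) (g B)) : Covers (f '' V) (L.map g) :=
  ⟨h.finite.image f,
    fun y ⟨x, hx, hxy⟩ => by
      obtain ⟨B, hB, hxB⟩ := h.exists_box x hx
      exact ⟨g B, List.mem_map_of_mem hB, hxy ▸ hfg x B hxB⟩,
    fun B' hB' => by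
      obtain ⟨B, hB, rfl⟩ := List.mem_map.1 hB'
      obtain ⟨x, hx, hxB⟩ := h.exists_mem B hB
      exact ⟨f x, mem_image_of_mem f hx, hfg x B hxB⟩⟩

end Covers

/-! ### The test for Rupert's property -/

/-- The value of an integral linear form on a box. -/
def linBox (m : ℤ × ℤ × ℤ) (B : Box) : Ival :=
  Ival.add (Ival.add (Ival.smul m.1 B.1) (Ival.smul m.2.1 B.2.1)) (Ival.smul m.2.2 B.2.2)

theorem encl_linBox (m : ℤ × ℤ × ℤ) {x : Space} {B : Box} (h : BoxMem x B) :
    Encl (m.1 * x 0 + m.2.1 * x 1 + m.2.2 * x 2) (linBox m B) := by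
  have h1 := Encl.smul m.1 h.1
  have h2 := Encl.smul m.2.1 h.2
  have h3 := Encl.smul m.2.2 h.3
  exact Encl.add

/-- Quaternions with integral coefficients. -/
abbrev Quat : Type := ℤ × ℤ × ℤ × ℤ

/-- The squared norm of a quaternion. -/
def quatNorm (q : Quat) : ℤ := q.1 * q.1 + q.2.1 * q.2.1 + q.2.2.1 * q.2.2.1 + q.2.2.2 * q.2.2.2

/-- The first row of the rotation matrix of a quaternion, multiplied by `k`. -/
def quatRow₁ (k : ℤ) : Quat → ℤ × ℤ × ℤ
  | (a, b, c, d) => (k * (a * a + b * b - c * c - d * d), k * (2 * (b * c - a * d)),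
      k * (2 * (b * d + a * c)))

/-- The second row of the rotation matrix of a quaternion, multiplied by `k`. -/
def quatRow₂ (k : ℤ) : Quat → ℤ × ℤ × ℤ
  | (a, b, c, d) => (k * (2 * (b * c + a * d)), k * (a * a - b * b + c * c - d * d),
      k * (2 * (c * d - a * b)))

/-- The pairs of cyclically consecutive elements of the list `p :: l`, ending with `f`. -/
def cyclicPairs {α : Type*} (f : α) : α → List α → List (α × α)
  | p, [] => [(p, f)]
  | p, q :: l => (p, q) :: cyclicPairs f q l

/-- The closing element `f` stays fixed while the starting element `p` runs through the induction.
For `p = f` the lemma says that every corner has a successor on the polygon. -/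
theorem exists_mem_cyclicPairs {α : Type*} (f : α) (p : α) (l : List α) :
    ∀ w ∈ p :: l, ∃ w' ∈ f :: l, (w, w') ∈ cyclicPairs f p l := by
  induction l generalizing p with
  | nil =>
    intro w hw
    rw [List.mem_singleton] at hw
    exact ⟨f, by simp, by simp [cyclicPairs, hw]⟩
  | cons q l ih =>
    intro w hw
    rcases List.mem_cons.1 hw with rfl | hw
    · exact ⟨q, by simp, by simp [cyclicPairs]⟩
    · obtain ⟨w', hw', h⟩ := ih q w hw
      refine ⟨w', ?_, List.mem_cons_of_mem _ h⟩
      rcases List.mem_cons.1 hw' with rfl | h'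
      · simp
      · exact List.mem_cons_of_mem _ (List.mem_cons_of_mem _ h')

/-- A sufficient condition for the cross product of two plane vectors to be positive. -/
def crossPos (d e : Rect) : Bool :=
  d.1.ok && d.2.ok && e.1.ok && e.2.ok && decide
    (Ival.max4 (d.2.lo * e.1.lo) (d.2.lo * e.1.hi) (d.2.hi * e.1.lo) (d.2.hi * e.1.hi) <
      Ival.min4 (d.1.lo * e.2.lo) (d.1.lo * e.2.hi) (d.1.hi * e.2.lo) (d.1.hi * e.2.hi))

/-- The rectangle `a` contains the complex number `z`. -/
def RectMem (z : ℂ) (a : Rect) : Prop := Encl z.re a.1 ∧ Encl z.im a.2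

/-- The two products are compared as exact integers, before any division by the scale, so that
nothing is lost by rounding. -/
theorem cross_pos_of_crossPos {z w : ℂ} {d e : Rect} (hz : RectMem z d) (hw : RectMem w e)
    (h : crossPos d e = true) : 0 < cross z w := by
  simp only [crossPos, Bool.and_eq_true, decide_eq_true_eq] at h
  obtain ⟨⟨⟨⟨h1, h2⟩, h3⟩, h4⟩, h⟩ := h
  have e1 := (Encl.mul_mem_minmax (hz.1.mem h1) (hw.2.mem h4)).1
  have e2 := (Encl.mul_mem_minmax (hz.2.mem h2) (hw.1.mem h3)).2
  have h' : ((Ival.max4 (d.2.lo * e.1.lo) (d.2.lo * e.1.hi) (d.2.hi * e.1.lo)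
      (d.2.hi * e.1.hi) : ℤ) : ℝ) < Ival.min4 (d.1.lo * e.2.lo) (d.1.lo * e.2.hi)
      (d.1.hi * e.2.lo) (d.1.hi * e.2.hi) := by exact_mod_cast h
  have e3 : 0 < cross z w * ((Ival.scale : ℝ) * Ival.scale) := by
    unfold cross
    linarith
  exact pos_of_mul_pos_left e3 (mul_nonneg Encl.scale_pos.le Encl.scale_pos.le)

/-- Differences of rectangles. -/
def Rect.sub (a b : Rect) : Rect := (Ival.sub a.1 b.1, Ival.sub a.2 b.2)

theorem RectMem.sub {z w : ℂ} {a b : Rect} (hz : RectMem z a) (hw : RectMem w b) :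
    RectMem (z - w) (Rect.sub a b) := by
  obtain ⟨h1, h2⟩ := hz
  obtain ⟨h3, h4⟩ := hw
  exact ⟨Encl.sub, Encl.sub⟩

/-- The image of a box under two integral linear forms, translated by `t / 1000`. -/
def projBox (m₁ m₂ : ℤ × ℤ × ℤ) (t : ℤ × ℤ) (B : Box) : Rect :=
  (Ival.add (linBox m₁ B) (Ival.ofRat t.1 1000), Ival.add (linBox m₂ B) (Ival.ofRat t.2 1000))

/-! ### Nondegeneracy: four vertices that span the space -/

/-- The determinant of the differences of four points. -/
def tetVolume (x₀ x₁ x₂ x₃ : Space) : ℝ :=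
  (x₁ 0 - x₀ 0) * ((x₂ 1 - x₀ 1) * (x₃ 2 - x₀ 2) - (x₂ 2 - x₀ 2) * (x₃ 1 - x₀ 1)) -
    (x₁ 1 - x₀ 1) * ((x₂ 0 - x₀ 0) * (x₃ 2 - x₀ 2) - (x₂ 2 - x₀ 2) * (x₃ 0 - x₀ 0)) +
    (x₁ 2 - x₀ 2) * ((x₂ 0 - x₀ 0) * (x₃ 1 - x₀ 1) - (x₂ 1 - x₀ 1) * (x₃ 0 - x₀ 0))

/-- Cramer's rule: replacing `xᵢ` by `y + x₀` puts `y` in the place of the difference `xᵢ - x₀`, so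
quotients of determinants are the coordinates of `y` in the basis of differences. -/
theorem interior_convexHull_nonempty_of_tetVolume {V : Set Space} {x₀ x₁ x₂ x₃ : Space}
    (h₀ : x₀ ∈ V) (h₁ : x₁ ∈ V) (h₂ : x₂ ∈ V) (h₃ : x₃ ∈ V) (h : tetVolume x₀ x₁ x₂ x₃ ≠ 0) :
    (interior (convexHull ℝ V)).Nonempty := by
  rw [interior_convexHull_nonempty_iff_affineSpan_eq_top,
    AffineSubspace.affineSpan_eq_top_iff_vectorSpan_eq_top_of_nonempty ℝ Space Space ⟨x₀, h₀⟩,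
    eq_top_iff]
  intro y _
  have m₁ := vsub_mem_vectorSpan ℝ h₁ h₀
  have m₂ := vsub_mem_vectorSpan ℝ h₂ h₀
  have m₃ := vsub_mem_vectorSpan ℝ h₃ h₀
  have hy : y = (tetVolume x₀ (y + x₀) x₂ x₃ / tetVolume x₀ x₁ x₂ x₃) • (x₁ -ᵥ x₀) +
      (tetVolume x₀ x₁ (y + x₀) x₃ / tetVolume x₀ x₁ x₂ x₃) • (x₂ -ᵥ x₀) +
      (tetVolume x₀ x₁ x₂ (y + x₀) / tetVolume x₀ x₁ x₂ x₃) • (x₃ -ᵥ x₀) := by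
    ext i
    simp only [vsub_eq_sub, PiLp.add_apply, PiLp.smul_apply, PiLp.sub_apply, smul_eq_mul]
    rw [div_mul_eq_mul_div, div_mul_eq_mul_div, div_mul_eq_mul_div, ← add_div, ← add_div,
      eq_div_iff h]
    fin_cases i <;> simp [tetVolume] <;> ring
  rw [hy]
  exact add_mem (add_mem (Submodule.smul_mem _ _ m₁) (Submodule.smul_mem _ _ m₂))
    (Submodule.smul_mem _ _ m₃)

/-- An interval for the determinant of the differences of four points in given boxes. -/
def tetVolumeBox (B₀ B₁ B₂ B₃ : Box) : Ival :=
  let d (B : Box) : Box := (Ival.sub B.1 B₀.1, Ival.sub B.2.1 B₀.2.1, Ival.sub B.2.2 B₀.2.2)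
  let p := d B₁
  let q := d B₂
  let r := d B₃
  Ival.add (Ival.sub
    (Ival.mul p.1 (Ival.sub (Ival.mul q.2.1 r.2.2) (Ival.mul q.2.2 r.2.1)))
    (Ival.mul p.2.1 (Ival.sub (Ival.mul q.1 r.2.2) (Ival.mul q.2.2 r.1))))
    (Ival.mul p.2.2 (Ival.sub (Ival.mul q.1 r.2.1) (Ival.mul q.2.1 r.1)))

theorem encl_tetVolume {x₀ x₁ x₂ x₃ : Space} {B₀ B₁ B₂ B₃ : Box} (h₀ : BoxMem x₀ B₀)
    (h₁ : BoxMem x₁ B₁) (h₂ : BoxMem x₂ B₂) (h₃ : BoxMem x₃ B₃) :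
    Encl (tetVolume x₀ x₁ x₂ x₃) (tetVolumeBox B₀ B₁ B₂ B₃) := by
  obtain ⟨a1, a2, a3⟩ := h₀
  obtain ⟨b1, b2, b3⟩ := h₁
  obtain ⟨c1, c2, c3⟩ := h₂
  obtain ⟨d1, d2, d3⟩ := h₃
  unfold tetVolume
  exact inferInstance

/-- Clearing the denominator keeps the linear forms integral. The factor `k` will be the squared
norm of the other quaternion, so that both views are enlarged equally. -/
theorem exists_rotation_quat (q : Quat) (hq : 0 < quatNorm q) : ∃ F : Space ≃ₗᵢ[ℝ] Space,
    ∀ (k : ℤ) (x : Space) (B : Box), BoxMem x B →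
      Encl (k * quatNorm q * (shadow (F x)).re) (linBox (quatRow₁ k q) B) ∧
      Encl (k * quatNorm q * (shadow (F x)).im) (linBox (quatRow₂ k q) B) := by
  obtain ⟨a, b, c, d⟩ := q
  have hq' : (0 : ℝ) < a * a + b * b + c * c + d * d := by
    simp only [quatNorm] at hq
    exact_mod_cast hq
  obtain ⟨F, hF⟩ := exists_rotation a b c d hq'
  refine ⟨F, fun k x B hx => ?_⟩
  obtain ⟨h1, h2⟩ := hF x
  have e1 := encl_linBox (quatRow₁ k (a, b, c, d)) hx
  have e2 := encl_linBox (quatRow₂ k (a, b, c, d)) hx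
  rw [shadow_re, shadow_im]
  constructor
  · convert e1 using 1
    simp only [quatNorm, quatRow₁, quatRows] at h1 ⊢
    push_cast
    linear_combination (k : ℝ) * h1
  · convert e2 using 1
    simp only [quatNorm, quatRow₂, quatRows] at h2 ⊢
    push_cast
    linear_combination (k : ℝ) * h2

/-- A box without information. -/
def anyBox : Box := (⟨false, 0, 0⟩, ⟨false, 0, 0⟩, ⟨false, 0, 0⟩)

/-- The test for the points in the boxes `L`: after the rotation `b` and the translation `t`, all
their shadows lie to the left of the edges of the polygon formed by the shadows, after the rotation
`a`, of the points with the numbers `i :: l`. Moreover, the points with the numbers in `f` span the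
space. -/
def rupertTest (L : List Box) (a b : Quat) (t : ℤ × ℤ) (i : ℕ) (l : List ℕ)
    (f : ℕ × ℕ × ℕ × ℕ) : Bool :=
  let vol := tetVolumeBox (L.getD f.1 anyBox) (L.getD f.2.1 anyBox) (L.getD f.2.2.1 anyBox)
    (L.getD f.2.2.2 anyBox)
  let outer := fun i => projBox (quatRow₁ (quatNorm b) a) (quatRow₂ (quatNorm b) a) (0, 0)
    (L.getD i anyBox)
  let inner := L.map (projBox (quatRow₁ (quatNorm a) b) (quatRow₂ (quatNorm a) b) t)
  let edges := (cyclicPairs i i l).map fun e => (outer e.1, Rect.sub (outer e.2) (outer e.1))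
  vol.ok && (decide (0 < vol.lo) || decide (vol.hi < 0)) &&
    (f.1 :: f.2.1 :: f.2.2.1 :: f.2.2.2 :: i :: l).all (fun j => decide (j < L.length)) && decide (0 < quatNorm a) &&
    decide (0 < quatNorm b) &&
    edges.all fun e => inner.all fun p => crossPos e.2 (Rect.sub p e.1)

theorem hasRupertProperty_of_test {V : Set Space} {L : List Box} [h : Covers V L] (a b : Quat)
    (t : ℤ × ℤ) (i : ℕ) (l : List ℕ) (f : ℕ × ℕ × ℕ × ℕ) (ht : rupertTest L a b t i l f = true) :
    HasRupertProperty V := by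
  simp only [rupertTest, Bool.and_eq_true, Bool.or_eq_true, decide_eq_true_eq, List.all_eq_true,
    List.mem_map, forall_exists_index, and_imp, forall_apply_eq_imp_iff₂] at ht
  obtain ⟨⟨⟨⟨⟨hok, hvol⟩, hil⟩, ha⟩, hb⟩, hedge⟩ := ht
  -- The corners of the outer polygon must be shadows of true vertices, which is why each box is
  -- required to meet `V`; the inner points only need to be covered.
  have hbox : ∀ j < L.length, ∃ x ∈ V, BoxMem x (L.getD j anyBox) := fun j hj => by
    rw [List.getD_eq_getElem _ _ hj]
    exact h.exists_mem _ (List.getElem_mem hj)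
  -- For a number out of range the default box claims nothing, so any point serves and `x` can be
  -- chosen for all numbers.
  have hpt : ∀ j, ∃ x, (j < L.length → x ∈ V) ∧ BoxMem x (L.getD j anyBox) := fun j => by
    by_cases hj : j < L.length
    · obtain ⟨x, hx, hxB⟩ := hbox j hj
      exact ⟨x, fun _ => hx, hxB⟩
    · refine ⟨0, fun h => absurd h hj, ?_⟩
      rw [List.getD_eq_default _ _ (not_lt.1 hj)]
      exact ⟨⟨fun h => by simp [anyBox] at h⟩, ⟨fun h => by simp [anyBox] at h⟩,
        ⟨fun h => by simp [anyBox] at h⟩⟩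
  choose x hxV hxB using hpt
  have hint : (interior (convexHull ℝ V)).Nonempty := by
    refine interior_convexHull_nonempty_of_tetVolume (hxV _ (hil f.1 (by simp)))
      (hxV _ (hil f.2.1 (by simp))) (hxV _ (hil f.2.2.1 (by simp)))
      (hxV _ (hil f.2.2.2 (by simp))) fun h0 => ?_
    -- If the determinant were zero, its interval would contain zero, but the test has found an end
    -- point of the wrong sign.
    have := (encl_tetVolume (hxB f.1) (hxB f.2.1) (hxB f.2.2.1) (hxB f.2.2.2)).mem hok
    rw [h0, zero_mul] at this
    norm_cast at this
    omega
  obtain ⟨F, hF⟩ := exists_rotation_quat a ha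
  obtain ⟨G, hG⟩ := exists_rotation_quat b hb
  have ha' : (0 : ℝ) < quatNorm a := by exact_mod_cast ha
  have hb' : (0 : ℝ) < quatNorm b := by exact_mod_cast hb
  set k : ℝ := quatNorm b * quatNorm a with hk
  have hk0 : 0 < k := mul_pos hb' ha'
  -- The test works with shadows enlarged by `k`, so its translation, given in thousandths, has to
  -- be divided by `k`.
  let τ : ℂ := ⟨(t.1 : ℝ) / (1000 : ℕ) / k, (t.2 : ℝ) / (1000 : ℕ) / k⟩
  refine hasRupertProperty_of_shadow h.finite hint F G τ fun y hy => ?_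
  obtain ⟨B, hB, hyB⟩ := h.exists_box y hy
  let w : ℕ → ℂ := fun j => shadow (F (x j))
  have hw : ∀ j, RectMem (k * w j) (projBox (quatRow₁ (quatNorm b) a) (quatRow₂ (quatNorm b) a)
      (0, 0) (L.getD j anyBox)) := fun j => by
    obtain ⟨h1, h2⟩ := hF (quatNorm b) _ _ (hxB j)
    have h3 := Encl.ofRat 0 1000
    constructor
    · rw [Complex.re_ofReal_mul, ← add_zero (k * _), show (0 : ℝ) = (0 : ℤ) / (1000 : ℕ) by simp]
      exact Encl.add
    · rw [Complex.im_ofReal_mul, ← add_zero (k * _), show (0 : ℝ) = (0 : ℤ) / (1000 : ℕ) by simp]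
      exact Encl.add
  set p : ℂ := shadow (G y) + τ with hp
  have hpR : RectMem (k * p) (projBox (quatRow₁ (quatNorm a) b) (quatRow₂ (quatNorm a) b) t B) := by
    obtain ⟨h1, h2⟩ := hG (quatNorm a) _ _ hyB
    rw [mul_comm (quatNorm a : ℝ), ← hk] at h1 h2
    have h3 := Encl.ofRat t.1 1000
    have h4 := Encl.ofRat t.2 1000
    constructor
    · rw [Complex.re_ofReal_mul, hp, Complex.add_re, mul_add,
        show k * τ.re = (t.1 : ℝ) / (1000 : ℕ) by simp only [τ]; field_simp]
      exact Encl.add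
    · rw [Complex.im_ofReal_mul, hp, Complex.add_im, mul_add,
        show k * τ.im = (t.2 : ℝ) / (1000 : ℕ) by simp only [τ]; field_simp]
      exact Encl.add
  have hsub : w '' {j | j ∈ i :: l} ⊆ (fun x => shadow (F x)) '' V := by
    rintro _ ⟨j, hj, rfl⟩
    refine mem_image_of_mem _ (hxV j (hil j ?_))
    simp only [mem_ofPred_eq, List.mem_cons] at hj ⊢
    tauto
  refine interior_mono (convexHull_mono hsub) ?_
  refine mem_interior_convexHull_of_cross_pos ((List.finite_toSet _).image w)
    (Nonempty.image w ⟨i, by simp⟩) ((cyclicPairs i i l).map (Prod.map w w)) ?_ ?_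
  · rintro _ ⟨j, hj, rfl⟩
    obtain ⟨j', hj', h⟩ := exists_mem_cyclicPairs i i l j hj
    exact ⟨w j', mem_image_of_mem w hj', List.mem_map.2 ⟨(j, j'), h, rfl⟩⟩
  · intro e he
    obtain ⟨⟨j, j'⟩, hjj, rfl⟩ := List.mem_map.1 he
    have hc := cross_pos_of_crossPos ((hw j').sub (hw j)) (hpR.sub (hw j)) (hedge _ hjj _ hB)
    simp only [Prod.map]
    -- Both cross products are twice the signed area of the triangle `w j`, `w j'`, `p`, seen from
    -- different corners; the enlargement contributes `k²`.
    have e1 : cross (k * w j' - k * w j) (k * p - k * w j) =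
        cross (w j - p) (w j' - p) * (k * k) := by
      simp only [cross, Complex.sub_re, Complex.sub_im, Complex.re_ofReal_mul,
        Complex.im_ofReal_mul]
      ring
    rw [e1] at hc
    exact pos_of_mul_pos_left hc (mul_nonneg hk0.le hk0.le)

/-! ### Boxes for regular polygons and the solids built from them -/

/-- The angle `θ` is the multiple `j * π / 240`. -/
class Angle (θ : ℝ) (j : outParam ℕ) : Prop where
  eq : θ = j * (Real.pi / 240)

instance : Angle 0 0 := ⟨by simp⟩
instance : Angle (Real.pi / 3) 80 := ⟨by push_cast; ring⟩
instance : Angle (Real.pi / 4) 60 := ⟨by push_cast; ring⟩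
instance : Angle (Real.pi / 5) 48 := ⟨by push_cast; ring⟩
instance : Angle (Real.pi / 6) 40 := ⟨by push_cast; ring⟩
instance : Angle (Real.pi / 8) 30 := ⟨by push_cast; ring⟩
instance : Angle (Real.pi / 10) 24 := ⟨by push_cast; ring⟩

instance {θ η : ℝ} {i j : ℕ} [h₁ : Angle θ i] [h₂ : Angle η j] : Angle (θ + η) (i + j) :=
  ⟨by rw [h₁.eq, h₂.eq]; push_cast; ring⟩

/-- The number `n` divides `120`, with quotient `h`. -/
class Divides (n : ℕ) (h : outParam ℕ) : Prop where
  eq : n * h = 120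

instance : Divides 3 40 := ⟨rfl⟩
instance : Divides 4 30 := ⟨rfl⟩
instance : Divides 5 24 := ⟨rfl⟩
instance : Divides 6 20 := ⟨rfl⟩
instance : Divides 8 15 := ⟨rfl⟩
instance : Divides 10 12 := ⟨rfl⟩

theorem Divides.cast_eq {n h : ℕ} (d : Divides n h) : (n : ℝ) ≠ 0 ∧ (n : ℝ) * h = 120 := by
  have h1 := d.eq
  refine ⟨fun h0 => ?_, by exact_mod_cast h1⟩
  have h2 : n = 0 := by exact_mod_cast h0
  simp [h2] at h1

/-- The point at the angle `j * π / 240` on the unit circle. -/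
def cisBox (j : ℕ) : Rect := Rect.pow 10 cisUnit j

/-- Depth ten is informative for exponents up to 511, more than the 480 steps of a full turn. -/
theorem enclPolar_cisBox (j : ℕ) : EnclPolar 1 (j * (Real.pi / 240)) (cisBox j) :=
  enclPolar_cisUnit.pow 10 j

theorem encl_cos {θ : ℝ} (j : ℕ) (h : θ = j * (Real.pi / 240)) : Encl (Real.cos θ) (cisBox j).1 := by
  have := (enclPolar_cisBox j).1
  rwa [one_mul, ← h] at this

theorem encl_sin {θ : ℝ} (j : ℕ) (h : θ = j * (Real.pi / 240)) : Encl (Real.sin θ) (cisBox j).2 := by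
  have := (enclPolar_cisBox j).2
  rwa [one_mul, ← h] at this

theorem Divides.angle {n h : ℕ} (d : Divides n h) (k : ℕ) :
    2 * Real.pi * k / n = (4 * h * k : ℕ) * (Real.pi / 240) := by
  obtain ⟨h0, h1⟩ := d.cast_eq
  rw [div_eq_iff h0]
  push_cast
  linear_combination (-(2 * Real.pi * k) / 120) * h1

instance encl_cos_angle {n h : ℕ} [d : Divides n h] (k : ℕ) :
    Encl (Real.cos (2 * Real.pi * k / n)) (cisBox (4 * h * k)).1 :=
  encl_cos _ (d.angle k)

instance encl_sin_angle {n h : ℕ} [d : Divides n h] (k : ℕ) :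
    Encl (Real.sin (2 * Real.pi * k / n)) (cisBox (4 * h * k)).2 :=
  encl_sin _ (d.angle k)

theorem Divides.half_angle {n h : ℕ} (d : Divides n h) :
    Real.pi / n = (2 * h : ℕ) * (Real.pi / 240) := by
  obtain ⟨h0, h1⟩ := d.cast_eq
  rw [div_eq_iff h0]
  push_cast
  linear_combination (-Real.pi / 120) * h1

instance Divides.angle_pi_div {n h : ℕ} [d : Divides n h] : Angle (Real.pi / n) (2 * h) :=
  ⟨d.half_angle⟩

instance encl_circumradius {n h : ℕ} [d : Divides n h] : Encl (circumradius n)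
    (Ival.mul (Ival.ofInt 1) (Ival.inv (Ival.mul (Ival.ofInt 2) (cisBox (2 * h)).2))) := by
  have := encl_sin _ d.half_angle
  unfold circumradius
  exact inferInstance

instance encl_inradius {n h : ℕ} [d : Divides n h] : Encl (inradius n)
    (Ival.mul (Ival.ofInt 1) (Ival.inv (Ival.mul (Ival.ofInt 2)
      (Ival.mul (cisBox (2 * h)).2 (Ival.inv (cisBox (2 * h)).1))))) := by
  have := encl_sin _ d.half_angle
  have := encl_cos _ d.half_angle
  unfold inradius
  rw [Real.tan_eq_sin_div_cos]
  exact inferInstance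

instance encl_capHeight {n : ℕ} {a : Ival} [Encl (circumradius n) a] :
    Encl (capHeight n) (Ival.sqrt (Ival.sub (Ival.ofInt 1) (Ival.mul a a))) := by
  unfold capHeight
  exact inferInstance

/-- An interval for `1 / (2 cos x)`, if `a` is one for `cos x`. -/
def halfSec (a : Ival) : Ival := Ival.mul (Ival.ofInt 1) (Ival.inv (Ival.mul (Ival.ofInt 2) a))

instance encl_antiprismHeight {n h : ℕ} [d : Divides n h] : Encl (antiprismHeight n)
    (Ival.sqrt (Ival.sub (Ival.ofInt 1)
      (Ival.mul (halfSec (cisBox h).1) (halfSec (cisBox h).1)))) := by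
  have : Encl (Real.cos (Real.pi / (2 * n))) (cisBox h).1 := encl_cos _ (by
    obtain ⟨h0, h1⟩ := d.cast_eq
    rw [div_eq_iff (mul_ne_zero two_ne_zero h0)]
    linear_combination (-Real.pi / 120) * h1)
  unfold antiprismHeight
  have : Encl (1 / (2 * Real.cos (Real.pi / (2 * n)))) (halfSec (cisBox h).1) :=
    inferInstanceAs (Encl _ (Ival.mul _ (Ival.inv (Ival.mul _ _))))
  exact inferInstance

instance encl_goldenRatio : Encl Real.goldenRatio
    (Ival.mul (Ival.add (Ival.ofInt 1) (Ival.sqrt (Ival.ofInt (5 : ℕ))))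
      (Ival.inv (Ival.ofInt (2 : ℕ)))) := by
  unfold Real.goldenRatio
  exact inferInstance

/-- The first `n` terms of the geometric progression with quotient `ζ` that begins with `c`. -/
def progression (ζ : Rect) : ℕ → Rect → List Rect
  | 0, _ => []
  | n + 1, c => c :: progression ζ n (Rect.mul c ζ)

/-- The vertices of a ring are computed by one complex multiplication each. Both inclusions are
needed: every vertex has its box, and every box its vertex. -/
theorem enclPolar_progression {ζ : Rect} {η : ℝ} (hζ : EnclPolar 1 η ζ) (r : ℝ) (n : ℕ) :
    ∀ {θ : ℝ} {c : Rect}, EnclPolar r θ c →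
      (∀ k < n, ∃ a ∈ progression ζ n c, EnclPolar r (θ + k * η) a) ∧
      (∀ a ∈ progression ζ n c, ∃ k < n, EnclPolar r (θ + k * η) a) := by
  induction n with
  | zero => simp [progression]
  | succ n ih =>
    intro θ c hc
    have hc' := hc.mul hζ
    rw [mul_one] at hc'
    obtain ⟨h1, h2⟩ := ih hc'
    have e : ∀ k : ℕ, θ + η + k * η = θ + (k + 1 : ℕ) * η := fun k => by push_cast; ring
    constructor
    · rintro (_ | k) hk
      · exact ⟨c, by simp [progression], by simpa using hc⟩
      · obtain ⟨a, ha, h⟩ := h1 k (by omega)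
        exact ⟨a, List.mem_cons_of_mem _ ha, by rwa [e] at h⟩
    · intro a ha
      rcases List.mem_cons.1 ha with rfl | ha
      · exact ⟨0, by omega, by simpa using hc⟩
      · obtain ⟨k, hk, h⟩ := h2 a ha
        exact ⟨k + 1, by omega, by rwa [e] at h⟩

/-- Boxes for the vertices of a regular polygon. -/
def ringBoxes (n h : ℕ) (r : Ival) (j : ℕ) (z : Ival) : List Box :=
  (progression (cisBox (4 * h)) n (Ival.mul r (cisBox j).1, Ival.mul r (cisBox j).2)).map
    fun p => (p.1, p.2, z)

instance covers_ring {n h : ℕ} [d : Divides n h] {r θ z : ℝ} {a c : Ival} {j : ℕ} [hr : Encl r a]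
    [hθ : Angle θ j] [hz : Encl z c] : Covers (ring n r θ z) (ringBoxes n h a j c) := by
  have h0 : EnclPolar r θ (Ival.mul a (cisBox j).1, Ival.mul a (cisBox j).2) := by
    have := encl_cos _ hθ.eq
    have := encl_sin _ hθ.eq
    exact ⟨Encl.mul, Encl.mul⟩
  have hζ := enclPolar_cisBox (4 * h)
  obtain ⟨h1, h2⟩ := enclPolar_progression hζ r n h0
  have e : ∀ k : ℕ, θ + k * ((4 * h : ℕ) * (Real.pi / 240)) = θ + 2 * Real.pi * k / n := fun k => by
    rw [d.angle k]
    push_cast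
    ring
  refine ⟨finite_range _, ?_, ?_⟩
  · rintro _ ⟨k, rfl⟩
    obtain ⟨p, hp, hk⟩ := h1 k k.2
    rw [e] at hk
    exact ⟨_, List.mem_map_of_mem hp, boxMem_pt (hx := hk.1) (hy := hk.2)⟩
  · intro B hB
    obtain ⟨p, hp, rfl⟩ := List.mem_map.1 hB
    obtain ⟨k, hk, hkp⟩ := h2 p hp
    rw [e] at hkp
    exact ⟨_, ⟨⟨k, hk⟩, rfl⟩, boxMem_pt (hx := hkp.1) (hy := hkp.2)⟩

instance covers_ngon {n : ℕ} {θ z : ℝ} {L : List Box} [h : Covers (ring n (circumradius n) θ z) L] :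
    Covers (ngon n θ z) L := h

instance covers_rotundaCap {θ z s : ℝ} {L : List Box} [h : Covers
    (ring 5 (Real.goldenRatio * circumradius 5) (θ + Real.pi / 5)
      (z + s * √(Real.goldenRatio ^ 2 - (Real.goldenRatio * circumradius 5) ^ 2)) ∪
    ngon 5 θ (z + s * √(Real.goldenRatio ^ 2 - circumradius 5 ^ 2))) L] :
    Covers (rotundaCap θ z s) L := h

instance covers_prism {n : ℕ} {L : List Box} [h : Covers
    (ngon n (Real.pi / n) (1 / 2) ∪ ngon n (Real.pi / n) (-(1 / 2))) L] :
    Covers (prism n) L := h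

local notation "φ" => Real.goldenRatio

/-! ### Solids given by coordinates -/

instance boxMem_prismApex {n k : ℕ} {B : Box} [h : BoxMem
    (pt ((inradius n + capHeight 4) * Real.cos (2 * Real.pi * k / n))
      ((inradius n + capHeight 4) * Real.sin (2 * Real.pi * k / n)) 0) B] :
    BoxMem (prismApex n k) B := h

instance covers_signedPair {x y z : ℝ} {L : List Box}
    [h : Covers {pt x y z, pt x (-y) z, pt (-x) y z, pt (-x) (-y) z} L] :
    Covers (signedPair x y z) L := h

instance covers_evenSigned {x y z : ℝ} {L : List Box}
    [h : Covers {pt x y z, pt x (-y) (-z), pt (-x) y (-z), pt (-x) (-y) z} L] :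
    Covers (evenSigned x y z) L := h

instance covers_cyc {x y z : ℝ} {L : List Box} [h : Covers {pt x y z, pt y z x, pt z x y} L] :
    Covers (cyc x y z) L := h

instance covers_signed {x y z : ℝ} {L : List Box} [h : Covers
    {pt x y z, pt x y (-z), pt x (-y) z, pt x (-y) (-z),
      pt (-x) y z, pt (-x) y (-z), pt (-x) (-y) z, pt (-x) (-y) (-z)} L] :
    Covers (signed x y z) L := h

instance covers_signedCyc {x y z : ℝ} {L : List Box}
    [h : Covers (signed x y z ∪ signed y z x ∪ signed z x y) L] : Covers (signedCyc x y z) L := h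

instance covers_spheno {k : ℝ} {L : List Box} [h : Covers
    (signedPair 0 (1 / 2) √(1 - k ^ 2) ∪ signedPair k (1 / 2) 0 ∪
      signedPair 0 (1 / 2 + √(3 / 4 - k ^ 2) / √(1 - k ^ 2)) ((1 / 2 - k ^ 2) / √(1 - k ^ 2))) L] :
    Covers (spheno k) L := h

instance covers_truncatedCubeCap {s : ℝ} {L : List Box} [h : Covers
    {pt √2 0 (s * (1 + 2 * √2)), pt (-√2) 0 (s * (1 + 2 * √2)),
      pt 0 √2 (s * (1 + 2 * √2)), pt 0 (-√2) (s * (1 + 2 * √2))} L] :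
    Covers (truncatedCubeCap s) L := h

instance covers_truncatedTetrahedron {L : List Box}
    [h : Covers (evenSigned 1 1 3 ∪ evenSigned 1 3 1 ∪ evenSigned 3 1 1) L] :
    Covers truncatedTetrahedron L := h

instance covers_truncatedCube {L : List Box} [h : Covers (signedCyc 1 (1 + √2) (1 + √2)) L] :
    Covers truncatedCube L := h

/-! ### Exact coordinates in the ring of golden integers -/

/-- Golden integers `a + b φ`. -/
abbrev GInt : Type := ℤ × ℤ

/-- The real number `a + b φ`. -/
noncomputable def GInt.val (p : GInt) : ℝ := p.1 + p.2 * φ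

/-- Irrationality of `φ` makes the coefficients unique, so equality of the real values is decided by
comparing integers. -/
theorem GInt.val_injective : Function.Injective GInt.val := by
  intro p q h
  simp only [GInt.val] at h
  have h2 : p.2 = q.2 := by
    by_contra hne
    -- If the coefficients of `φ` differed, solving the equation for `φ` would give this rational
    -- number.
    refine Real.goldenRatio_irrational ⟨(q.1 - p.1 : ℚ) / (p.2 - q.2 : ℚ), ?_⟩
    have : ((p.2 : ℝ) - q.2) ≠ 0 := by
      rw [sub_ne_zero]
      exact_mod_cast hne
    push_cast
    rw [div_eq_iff this]
    linarith
  rw [h2] at h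
  exact Prod.ext (by exact_mod_cast add_right_cancel h) h2

namespace GInt

/-- Products of golden integers. -/
def mul (p q : GInt) : GInt := (p.1 * q.1 + p.2 * q.2, p.1 * q.2 + p.2 * q.1 + p.2 * q.2)

theorem val_add (p q : GInt) : (p + q).val = p.val + q.val := by
  simp [val]
  ring

theorem val_neg (p : GInt) : (-p).val = -p.val := by
  simp [val]
  ring

theorem val_mul (p q : GInt) : (mul p q).val = p.val * q.val := by
  simp only [val, mul]
  push_cast
  linear_combination (-(p.2 : ℝ) * q.2) * Real.goldenRatio_sq

end GInt

/-- The real number `x` is the golden integer `p`. -/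
class IsGInt (x : ℝ) (p : outParam GInt) : Prop where
  eq : x = p.val

instance : IsGInt 0 (0, 0) := ⟨by simp [GInt.val]⟩
instance : IsGInt 1 (1, 0) := ⟨by simp [GInt.val]⟩
instance : IsGInt 2 (2, 0) := ⟨by simp [GInt.val]⟩
instance : IsGInt 3 (3, 0) := ⟨by simp [GInt.val]⟩
instance : IsGInt φ (0, 1) := ⟨by simp [GInt.val]⟩
instance : IsGInt φ⁻¹ (-1, 1) :=
  ⟨by rw [Real.inv_goldenRatio]; simp only [GInt.val]; push_cast; linarith [Real.goldenRatio_add_goldenConj]⟩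

instance {x y : ℝ} {p q : GInt} [hx : IsGInt x p] [hy : IsGInt y q] : IsGInt (x + y) (p + q) :=
  ⟨by rw [GInt.val_add, hx.eq, hy.eq]⟩

instance {x : ℝ} {p : GInt} [hx : IsGInt x p] : IsGInt (-x) (-p) :=
  ⟨by rw [GInt.val_neg, hx.eq]⟩

instance {x y : ℝ} {p q : GInt} [hx : IsGInt x p] [hy : IsGInt y q] : IsGInt (x * y) (p.mul q) :=
  ⟨by rw [GInt.val_mul, hx.eq, hy.eq]⟩

instance {x : ℝ} {p : GInt} [hx : IsGInt x p] : IsGInt (x ^ 2) (p.mul p) :=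
  ⟨by rw [GInt.val_mul, hx.eq, sq]⟩

instance {x : ℝ} {p : GInt} [hx : IsGInt x p] : IsGInt (x ^ 3) ((p.mul p).mul p) :=
  ⟨by rw [GInt.val_mul, GInt.val_mul, hx.eq, pow_succ, sq]⟩

/-- Vectors of golden integers. -/
abbrev GVec : Type := GInt × GInt × GInt

/-- The point with given golden integers as coordinates. -/
noncomputable def GVec.toPt (p : GVec) : Space := pt p.1.val p.2.1.val p.2.2.val

theorem GVec.toPt_injective : Function.Injective GVec.toPt := by
  intro p q h
  have h0 := congrArg (fun x : Space => x 0) h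
  have h1 := congrArg (fun x : Space => x 1) h
  have h2 := congrArg (fun x : Space => x 2) h
  simp only [toPt, pt] at h0 h1 h2
  exact Prod.ext (GInt.val_injective h0)
    (Prod.ext (GInt.val_injective h1) (GInt.val_injective h2))

/-- The inner product of vectors of golden integers. -/
def GVec.dot (p q : GVec) : GInt := p.1.mul q.1 + p.2.1.mul q.2.1 + p.2.2.mul q.2.2

theorem GVec.inner_toPt (p q : GVec) : inner ℝ p.toPt q.toPt = (p.dot q).val := by
  simp only [dot, GInt.val_add, GInt.val_mul]
  rw [PiLp.inner_apply, Fin.sum_univ_three]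
  simp [toPt, pt]
  ring

/-- The point `x` has the golden integral coordinates `p`. -/
class IsGVec (x : Space) (p : outParam GVec) : Prop where
  eq : x = p.toPt

instance {x y z : ℝ} {p q r : GInt} [hx : IsGInt x p] [hy : IsGInt y q] [hz : IsGInt z r] :
    IsGVec (pt x y z) (p, q, r) := ⟨by rw [hx.eq, hy.eq, hz.eq]; rfl⟩

instance {x : Space} {p : GVec} [hx : IsGVec x p] : IsGVec (-x) (-p) :=
  ⟨by
    rw [hx.eq]
    ext i
    fin_cases i <;> simp [GVec.toPt, pt, GInt.val_neg]⟩

instance isGVec_axis₁ {p : GVec} [h : IsGVec (pt 0 φ (-1)) p] : IsGVec axis₁ p := h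

instance isGVec_axis₂ {p : GVec} [h : IsGVec (pt (-1) 0 φ) p] : IsGVec axis₂ p := h

instance isGVec_axis₃ {p : GVec} [h : IsGVec (pt φ (-1) 0) p] : IsGVec axis₃ p := h

/-- The set `V` consists of the points with the coordinates in `L`. -/
class IsGSet (V : Set Space) (L : outParam (List GVec)) : Prop where
  mem_iff : ∀ x, x ∈ V ↔ ∃ p ∈ L, x = p.toPt

namespace IsGSet

instance empty : IsGSet ∅ [] := ⟨by simp⟩

instance insert {V : Set Space} {L : List GVec} [h : IsGSet V L] {x : Space} {p : GVec}
    [hx : IsGVec x p] : IsGSet (insert x V) (p :: L) :=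
  ⟨fun y => by rw [mem_insert_iff, h.mem_iff, hx.eq]; simp⟩

instance singleton {x : Space} {p : GVec} [hx : IsGVec x p] : IsGSet {x} [p] :=
  ⟨fun y => by rw [mem_singleton_iff, hx.eq]; simp⟩

instance union {V W : Set Space} {L M : List GVec} [hV : IsGSet V L] [hW : IsGSet W M] :
    IsGSet (V ∪ W) (L ++ M) :=
  ⟨fun y => by
    rw [mem_union, hV.mem_iff, hW.mem_iff]
    simp only [List.mem_append, or_and_right, exists_or]⟩

/-- Discarding entries of the list is faithful because different golden coordinates give different
points; boxes could not certify that a point is absent. -/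
instance sdiff {V W : Set Space} {L M : List GVec} [hV : IsGSet V L] [hW : IsGSet W M] :
    IsGSet (V \ W) (L.filter fun p => M.all fun q => p != q) :=
  ⟨fun y => by
    simp only [Set.mem_sdiff, hV.mem_iff, hW.mem_iff, List.mem_filter, List.all_eq_true, bne_iff_ne]
    constructor
    · rintro ⟨⟨p, hp, rfl⟩, h⟩
      exact ⟨p, ⟨hp, fun q hq hpq => h ⟨q, hq, by rw [hpq]⟩⟩, rfl⟩
    · rintro ⟨p, ⟨hp, h⟩, rfl⟩
      exact ⟨⟨p, hp, rfl⟩, fun ⟨q, hq, hpq⟩ => h q hq (GVec.toPt_injective hpq)⟩⟩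

instance signed {x y z : ℝ} {L : List GVec} [h : IsGSet
    {pt x y z, pt x y (-z), pt x (-y) z, pt x (-y) (-z),
      pt (-x) y z, pt (-x) y (-z), pt (-x) (-y) z, pt (-x) (-y) (-z)} L] :
    IsGSet (signed x y z) L := h

instance signedCyc {x y z : ℝ} {L : List GVec} [h : IsGSet
    (JohnsonSolids.signed x y z ∪ JohnsonSolids.signed y z x ∪ JohnsonSolids.signed z x y) L] :
    IsGSet (signedCyc x y z) L := h

instance icosahedron {L : List GVec} [h : IsGSet (JohnsonSolids.signedCyc 0 φ 1) L] :
    IsGSet icosahedron L := h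

instance dodecahedron {L : List GVec}
    [h : IsGSet (JohnsonSolids.signed 1 1 1 ∪ JohnsonSolids.signedCyc 0 φ⁻¹ φ) L] :
    IsGSet dodecahedron L := h

instance truncatedDodecahedron {L : List GVec} [h : IsGSet
    (JohnsonSolids.signedCyc 0 φ⁻¹ (2 + φ) ∪ JohnsonSolids.signedCyc φ⁻¹ φ (2 * φ) ∪
      JohnsonSolids.signedCyc φ 2 (φ + 1)) L] :
    IsGSet truncatedDodecahedron L := h

instance rhombicosidodecahedron {L : List GVec} [h : IsGSet
    (JohnsonSolids.signedCyc 1 1 (φ ^ 3) ∪ JohnsonSolids.signedCyc (φ ^ 2) φ (2 * φ) ∪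
      JohnsonSolids.signedCyc (2 + φ) 0 (φ ^ 2)) L] :
    IsGSet rhombicosidodecahedron L := h

end IsGSet

/-- An interval for the golden integer `a + b φ`. -/
def GInt.ival (p : GInt) : Ival :=
  Ival.add (Ival.ofInt p.1) (Ival.smul p.2 ⟨true, 1618033988749800, 1618033988749990⟩)

/-- The literal interval for `φ` contains the computed one, so the square root of five need not be
evaluated for every coordinate. -/
theorem GInt.encl_val (p : GInt) : Encl p.val p.ival := by
  have h1 := Encl.ofInt p.1
  have h2 := Encl.smul p.2 (encl_goldenRatio.mono
    (b := ⟨true, 1618033988749800, 1618033988749990⟩) (by decide +kernel))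
  unfold GInt.val
  exact Encl.add

/-- A box for a vector of golden integers. -/
def GVec.box (p : GVec) : Box := (p.1.ival, p.2.1.ival, p.2.2.ival)

theorem GVec.boxMem (p : GVec) : BoxMem p.toPt p.box :=
  ⟨p.1.encl_val, p.2.1.encl_val, p.2.2.encl_val⟩

instance boxMem_of_isGVec {x : Space} {p : GVec} [h : IsGVec x p] : BoxMem x p.box := by
  rw [h.eq]
  exact p.boxMem

theorem IsGSet.covers {V : Set Space} {L : List GVec} [h : IsGSet V L] :
    Covers V (L.map GVec.box) := by
  have hV : V = GVec.toPt '' {p | p ∈ L} := by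
    ext x
    rw [h.mem_iff]
    simp [eq_comm]
  refine ⟨hV ▸ (List.finite_toSet L).image _, fun x hx => ?_, fun B hB => ?_⟩
  · obtain ⟨p, hp, rfl⟩ := (h.mem_iff x).1 hx
    exact ⟨_, List.mem_map_of_mem hp, p.boxMem⟩
  · obtain ⟨p, hp, rfl⟩ := List.mem_map.1 hB
    exact ⟨_, (h.mem_iff _).2 ⟨p, hp, rfl⟩, p.boxMem⟩

instance covers_dodecahedron {L : List GVec} [IsGSet dodecahedron L] :
    Covers dodecahedron (L.map GVec.box) := IsGSet.covers

instance covers_truncatedDodecahedron {L : List GVec} [IsGSet truncatedDodecahedron L] :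
    Covers truncatedDodecahedron (L.map GVec.box) := IsGSet.covers

instance covers_icosahedron_sdiff {W : Set Space} {L : List GVec} [IsGSet (icosahedron \ W) L] :
    Covers (icosahedron \ W) (L.map GVec.box) := IsGSet.covers

/-! ### Apices and caps erected on golden polyhedra -/

/-- Scaled boxes. -/
def scaleBox (a : Ival) (B : Box) : Box := (Ival.mul a B.1, Ival.mul a B.2.1, Ival.mul a B.2.2)

instance boxMem_smul {r : ℝ} {x : Space} {a : Ival} {B : Box} [hr : Encl r a] [hx : BoxMem x B] :
    BoxMem (r • x) (scaleBox a B) := by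
  obtain ⟨h0, h1, h2⟩ := hx
  exact ⟨Encl.mul (hb := h0), Encl.mul (hb := h1), Encl.mul (hb := h2)⟩

instance boxMem_add {x y : Space} {A B : Box} [hx : BoxMem x A] [hy : BoxMem y B] :
    BoxMem (x + y) (Ival.add A.1 B.1, Ival.add A.2.1 B.2.1, Ival.add A.2.2 B.2.2) := by
  obtain ⟨h0, h1, h2⟩ := hx
  obtain ⟨h3, h4, h5⟩ := hy
  exact ⟨Encl.add (ha := h0) (hb := h3), Encl.add (ha := h1) (hb := h4), Encl.add (ha := h2) (hb := h5)⟩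

instance boxMem_sub {x y : Space} {A B : Box} [hx : BoxMem x A] [hy : BoxMem y B] :
    BoxMem (x - y) (Ival.sub A.1 B.1, Ival.sub A.2.1 B.2.1, Ival.sub A.2.2 B.2.2) := by
  obtain ⟨h0, h1, h2⟩ := hx
  obtain ⟨h3, h4, h5⟩ := hy
  exact ⟨Encl.sub (ha := h0) (hb := h3), Encl.sub (ha := h1) (hb := h4), Encl.sub (ha := h2) (hb := h5)⟩

instance boxMem_dodecahedronApex {u : Space} {B : Box} [h : BoxMem (((7 * φ - 6) / 5) • u) B] :
    BoxMem (dodecahedronApex u) B := h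

instance IsGSet.sep_inner {V : Set Space} {L : List GVec} [hV : IsGSet V L] {u : Space} {p : GVec}
    [hu : IsGVec u p] {r : ℝ} {c : GInt} [hr : IsGInt r c] :
    IsGSet {w | w ∈ V ∧ inner ℝ w u = r} (L.filter fun q => q.dot p == c) :=
  ⟨fun y => by
    simp only [mem_ofPred_eq, hV.mem_iff, List.mem_filter, beq_iff_eq, hu.eq, hr.eq]
    constructor
    · rintro ⟨⟨q, hq, rfl⟩, h⟩
      rw [GVec.inner_toPt] at h
      exact ⟨q, ⟨hq, GInt.val_injective h⟩, rfl⟩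
    · rintro ⟨q, ⟨hq, h⟩, rfl⟩
      exact ⟨⟨q, hq, rfl⟩, by rw [GVec.inner_toPt, h]⟩⟩

/-- A box for the translate by `a • u` of the dilate by `b` of a point, in terms of boxes. -/
def capBox (a b : Ival) (U W : Box) : Box :=
  (Ival.add (scaleBox a U).1 (scaleBox b W).1, Ival.add (scaleBox a U).2.1 (scaleBox b W).2.1,
    Ival.add (scaleBox a U).2.2 (scaleBox b W).2.2)

/-- The neighbours of `u` are selected exactly, by an equation in golden integers. Only then does
the computation pass to boxes, since the factor with denominator `5` is not a golden integer. -/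
instance covers_truncatedDodecahedronCap {u : Space} {p : GVec} [hu : IsGVec u p] {L : List GVec}
    [h : IsGSet {w | w ∈ JohnsonSolids.icosahedron ∧ inner ℝ w u = φ} L] {a b : Ival}
    [ha : Encl ((12 * φ - 11) / 5) a] [hb : Encl φ⁻¹ b] :
    Covers (truncatedDodecahedronCap u) ((L.map GVec.box).map (capBox a b p.box)) := by
  have e : truncatedDodecahedronCap u = (fun w => ((12 * φ - 11) / 5) • u + φ⁻¹ • w) ''
      {w | w ∈ JohnsonSolids.icosahedron ∧ inner ℝ w u = φ} := by
    ext x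
    simp only [truncatedDodecahedronCap, mem_ofPred_eq, mem_image, real_inner_comm u, and_assoc]
    exact exists_congr fun w => and_congr_right fun _ => and_congr_right fun _ => eq_comm
  rw [e]
  refine (IsGSet.covers (h := h)).image fun x B hx => ?_
  exact boxMem_add

instance IsGSet.rhombicosidodecahedronCap {u : Space} {L : List GVec}
    [h : IsGSet {x | x ∈ JohnsonSolids.rhombicosidodecahedron ∧ inner ℝ x u = 3 * φ + 3} L] :
    IsGSet (rhombicosidodecahedronCap u) L := h

/-! ### Gyrated and diminished rhombicosidodecahedra -/

/-- A box for the image of a point under a half-turn. -/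
def halfTurnBox (U B : Box) : Box :=
  let d (A : Box) : Ival :=
    Ival.add (Ival.add (Ival.mul U.1 A.1) (Ival.mul U.2.1 A.2.1)) (Ival.mul U.2.2 A.2.2)
  let S := scaleBox (Ival.mul (Ival.mul (Ival.ofInt (2 : ℕ)) (d B)) (Ival.inv (d U))) U
  (Ival.sub S.1 B.1, Ival.sub S.2.1 B.2.1, Ival.sub S.2.2 B.2.2)

/-- The division by `inner ℝ u u` leads out of the golden integers, so turned vertices are only
enclosed; no equality has to be decided for them. -/
theorem boxMem_halfTurn {u x : Space} {U B : Box} (hu : BoxMem u U) (hx : BoxMem x B) :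
    BoxMem (halfTurn u x) (halfTurnBox U B) := by
  have hd : ∀ {y : Space} {A : Box}, BoxMem y A → Encl (inner ℝ y u)
      (Ival.add (Ival.add (Ival.mul U.1 A.1) (Ival.mul U.2.1 A.2.1)) (Ival.mul U.2.2 A.2.2)) := by
    intro y A hy
    have : inner ℝ y u = u 0 * y 0 + u 1 * y 1 + u 2 * y 2 := by
      rw [PiLp.inner_apply, Fin.sum_univ_three]
      simp
    rw [this]
    obtain ⟨h0, h1, h2⟩ := hu
    obtain ⟨h3, h4, h5⟩ := hy
    exact Encl.add
  have h1 := hd hx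
  have h2 := hd hu
  exact boxMem_sub

/-- The result of turning the pentagonal cupolas around the normals in `G`. -/
def turnedCaps (G : Set Space) : Set Space :=
  {y | ∃ u ∈ G, ∃ x ∈ rhombicosidodecahedronCap u, y = halfTurn u x}

instance covers_turnedCaps_empty : Covers (turnedCaps ∅) [] := by
  have : turnedCaps ∅ = ∅ := by simp [turnedCaps]
  rw [this]
  infer_instance

instance covers_turnedCaps_insert {u : Space} {p : GVec} [hu : IsGVec u p] {G : Set Space}
    {L : List GVec} [IsGSet (rhombicosidodecahedronCap u) L] {M : List Box}
    [Covers (turnedCaps G) M] :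
    Covers (turnedCaps (insert u G)) ((L.map GVec.box).map (halfTurnBox p.box) ++ M) := by
  have : turnedCaps (insert u G) = halfTurn u '' rhombicosidodecahedronCap u ∪ turnedCaps G := by
    ext y
    simp [turnedCaps, eq_comm]
  rw [this]
  have : Covers (halfTurn u '' rhombicosidodecahedronCap u)
      ((L.map GVec.box).map (halfTurnBox p.box)) :=
    IsGSet.covers.image fun x B hx => boxMem_halfTurn boxMem_of_isGVec hx
  infer_instance

instance covers_turnedCaps_singleton {u : Space} {L : List Box}
    [h : Covers (turnedCaps (insert u ∅)) L] : Covers (turnedCaps {u}) L := by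
  rwa [← insert_empty_eq]

/-- The pair `(3, 3)` stands for `3 φ + 3`, the inner product that characterizes the cap around a
normal. Removing the caps is therefore an exact filter, and the turned caps are appended as boxes.
-/
instance covers_modifiedRhombicosidodecahedron {D G : Set Space} {L M N : List GVec} {K : List Box}
    [hR : IsGSet rhombicosidodecahedron L] [hD : IsGSet D M] [hG : IsGSet G N]
    [hK : Covers (turnedCaps G) K] :
    Covers (modifiedRhombicosidodecahedron D G)
      (((L.filter fun q => (M ++ N).all fun p => q.dot p != (3, 3)).map GVec.box) ++ K) := by
  have hS : IsGSet {x | x ∈ rhombicosidodecahedron ∧ ∀ u ∈ D ∪ G, x ∉ rhombicosidodecahedronCap u}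
      (L.filter fun q => (M ++ N).all fun p => q.dot p != (3, 3)) := by
    have hDG : IsGSet (D ∪ G) (M ++ N) := inferInstance
    have e : (3 * φ + 3 : ℝ) = GInt.val (3, 3) := by
      simp only [GInt.val]
      push_cast
      ring
    refine ⟨fun y => ?_⟩
    simp only [mem_ofPred_eq, hDG.mem_iff, rhombicosidodecahedronCap, List.mem_filter,
      List.all_eq_true, bne_iff_ne]
    constructor
    · rintro ⟨hy, h⟩
      obtain ⟨q, hq, rfl⟩ := (hR.mem_iff y).1 hy
      refine ⟨q, ⟨hq, fun p hp hqp => h _ ⟨p, hp, rfl⟩ ⟨hy, ?_⟩⟩, rfl⟩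
      rw [GVec.inner_toPt, hqp, e]
    · rintro ⟨q, ⟨hq, h⟩, rfl⟩
      refine ⟨(hR.mem_iff _).2 ⟨q, hq, rfl⟩, ?_⟩
      rintro _ ⟨p, hp, rfl⟩ ⟨-, hqp⟩
      rw [GVec.inner_toPt, e] at hqp
      exact h p hp (GInt.val_injective hqp)
  have := hS.covers
  exact inferInstanceAs (Covers (_ ∪ turnedCaps G) _)

/-! ### The algebraic numbers -/

/-- A change of sign provides a root. Its uniqueness is not needed: the infimum of any nonempty set
of points of the interval stays in the interval. Existence must be shown, because the infimum of the
empty set is `0` by convention. -/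
theorem sInf_mem_Icc {a b : ℝ} (hab : a ≤ b) {p : ℝ → Prop} {f : ℝ → ℝ} (hf : Continuous f)
    (hp : ∀ x, f x = 0 → p x) (h : f a ≤ 0 ∧ 0 ≤ f b ∨ 0 ≤ f a ∧ f b ≤ 0) :
    sInf {x | x ∈ Icc a b ∧ p x} ∈ Icc a b := by
  obtain ⟨x, hx, hfx⟩ : ∃ x ∈ Icc a b, f x = 0 := by
    rcases h with h | h
    · exact intermediate_value_Icc hab hf.continuousOn h
    · exact intermediate_value_Icc' hab hf.continuousOn ⟨h.2, h.1⟩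
  have hmem : x ∈ {x | x ∈ Icc a b ∧ p x} := ⟨hx, hp x hfx⟩
  refine ⟨le_csInf ⟨x, hmem⟩ fun y hy => hy.1.1, ?_⟩
  exact (csInf_le ⟨a, fun y hy => hy.1.1⟩ hmem).trans hx.2

instance encl_root84 : Encl root84 ⟨true, 169022220000000, 169022230000000⟩ := by
  obtain ⟨h1, h2⟩ : root84 ∈ Icc (0.16902222 : ℝ) 0.16902223 :=
    sInf_mem_Icc (by norm_num) (f := fun x => 2 * x ^ 3 + 11 * x ^ 2 + 4 * x - 1) (by fun_prop)
      (fun x hx => hx) (by norm_num)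
  refine ⟨fun _ => ?_⟩
  norm_num [Ival.scale] at h1 h2 ⊢
  constructor <;> linarith

/-- Square roots in the equation for `root85` are estimated by intervals. -/
theorem root85_sign (m : ℤ) {r : ℝ} {a : Ival} (hr : r = m / (100000000 : ℕ))
    (ha : ∀ [Encl r (Ival.ofRat m 100000000)], Encl
      ((√(1 / 2 + √2 * r - r ^ 2) - √(1 / 2 + r - r ^ 2)) ^ 2 - (1 - (2 - √2) * r ^ 2)) a)
    (hok : a.ok = true) :
    (0 ≤ a.lo → 0 ≤ (√(1 / 2 + √2 * r - r ^ 2) - √(1 / 2 + r - r ^ 2)) ^ 2 -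
      (1 - (2 - √2) * r ^ 2)) ∧
    (a.hi ≤ 0 → (√(1 / 2 + √2 * r - r ^ 2) - √(1 / 2 + r - r ^ 2)) ^ 2 -
      (1 - (2 - √2) * r ^ 2) ≤ 0) := by
  -- This is the enclosure that `ha` awaits; leaving it open there lets class resolution find `a` at
  -- each use.
  have : Encl r (Ival.ofRat m 100000000) := by
    rw [hr]
    exact Encl.ofRat m 100000000
  have h := ha.mem hok
  constructor
  · intro h0
    have : (0 : ℝ) ≤ a.lo := by exact_mod_cast h0
    exact nonneg_of_mul_nonneg_left (this.trans h.1) Encl.scale_pos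
  · intro h0
    have : (a.hi : ℝ) ≤ 0 := by exact_mod_cast h0
    exact nonpos_of_mul_nonpos_left (h.2.trans this) Encl.scale_pos

instance encl_root85 : Encl root85 ⟨true, 1213205540000000, 1213205550000000⟩ := by
  obtain ⟨h1, h2⟩ : root85 ∈ Icc (1.21320554 : ℝ) 1.21320555 :=
    sInf_mem_Icc (by norm_num)
      (f := fun r => (√(1 / 2 + √2 * r - r ^ 2) - √(1 / 2 + r - r ^ 2)) ^ 2 -
        (1 - (2 - √2) * r ^ 2)) (by fun_prop) (fun x hx => sub_eq_zero.1 hx)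
      -- The equation contains square roots, so the signs at the two ends come from interval
      -- arithmetic instead of rational evaluation.
      (Or.inl ⟨(root85_sign 121320554 (by norm_num) inferInstance (by decide +kernel)).2
          (by decide +kernel),
        (root85_sign 121320555 (by norm_num) inferInstance (by decide +kernel)).1
          (by decide +kernel)⟩)
  refine ⟨fun _ => ?_⟩
  norm_num [Ival.scale] at h1 h2 ⊢
  constructor <;> linarith

instance encl_root86 {a : Ival} [h : Encl ((6 + √6 + 2 * √(213 - 57 * √6)) / 30) a] :
    Encl root86 a := h

instance encl_root88 : Encl root88 ⟨true, 594633330000000, 594633340000000⟩ := by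
  obtain ⟨h1, h2⟩ : root88 ∈ Icc (0.59463333 : ℝ) 0.59463334 :=
    sInf_mem_Icc (by norm_num)
      (f := fun x => 1680 * x ^ 16 - 4800 * x ^ 15 - 3712 * x ^ 14 + 17216 * x ^ 13 + 1568 * x ^ 12
        - 24576 * x ^ 11 + 2464 * x ^ 10 + 17248 * x ^ 9 - 3384 * x ^ 8 - 5584 * x ^ 7
        + 2000 * x ^ 6 + 240 * x ^ 5 - 776 * x ^ 4 + 304 * x ^ 3 + 200 * x ^ 2 - 56 * x - 23)
      (by fun_prop) (fun x hx => hx) (by norm_num)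
  refine ⟨fun _ => ?_⟩
  norm_num [Ival.scale] at h1 h2 ⊢
  constructor <;> linarith

instance encl_root89 : Encl root89 ⟨true, 216844810000000, 216844820000000⟩ := by
  obtain ⟨h1, h2⟩ : root89 ∈ Icc (0.21684481 : ℝ) 0.21684482 :=
    sInf_mem_Icc (by norm_num)
      (f := fun x => 26880 * x ^ 10 + 35328 * x ^ 9 - 25600 * x ^ 8 - 39680 * x ^ 7 + 6112 * x ^ 6
        + 13696 * x ^ 5 + 2128 * x ^ 4 - 1808 * x ^ 3 - 1119 * x ^ 2 + 494 * x - 47)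
      (by fun_prop) (fun x hx => hx) (by norm_num)
  refine ⟨fun _ => ?_⟩
  norm_num [Ival.scale] at h1 h2 ⊢
  constructor <;> linarith

instance encl_root90 : Encl root90 ⟨true, 767131110000000, 767131120000000⟩ := by
  obtain ⟨h1, h2⟩ : root90 ∈ Icc (0.76713111 : ℝ) 0.76713112 :=
    sInf_mem_Icc (by norm_num)
      (f := fun x => 256 * x ^ 12 - 512 * x ^ 11 - 1664 * x ^ 10 + 3712 * x ^ 9 + 1552 * x ^ 8
        - 6592 * x ^ 7 + 1248 * x ^ 6 + 4352 * x ^ 5 - 2024 * x ^ 4 - 944 * x ^ 3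
        + 672 * x ^ 2 - 24 * x - 23)
      (by fun_prop) (fun x hx => hx) (by norm_num)
  refine ⟨fun _ => ?_⟩
  norm_num [Ival.scale] at h1 h2 ⊢
  constructor <;> linarith

/-! ### The individual solids -/

set_option synthInstance.maxSize 10000
set_option synthInstance.maxHeartbeats 400000

/-- For each solid the certificate consists of the quaternions of the outer and the inner view, the
translation, the first and the remaining corners of the outer polygon in counterclockwise order, and
four vertices that are not coplanar. The numbers refer to the list of boxes derived from the
definition. Translations look large because they are thousandths in a picture enlarged by both
squared norms. -/
theorem hasRupertProperty_J1 : HasRupertProperty J1 := by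
  unfold J1
  exact hasRupertProperty_of_test (0, 3, -7, 0) (-2, 0, 3, 2) (70652, -73712) 1
    [0, 3, 2] (0, 1, 2, 4) (by decide +kernel)

theorem hasRupertProperty_J2 : HasRupertProperty J2 := by
  unfold J2
  exact hasRupertProperty_of_test (0, 3, 4, 0) (1, 1, 1, 1) (-24931, -8333) 4
    [3, 2, 1, 0] (0, 1, 2, 5) (by decide +kernel)

theorem hasRupertProperty_J3 : HasRupertProperty J3 := by
  unfold J3
  exact hasRupertProperty_of_test (4, 0, 0, 3) (-3, -4, -6, 6) (-89021, 419571) 1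
    [2, 3, 4, 5, 0] (0, 1, 2, 8) (by decide +kernel)

theorem hasRupertProperty_J4 : HasRupertProperty J4 := by
  unfold J4
  exact hasRupertProperty_of_test (4, 0, 0, -1) (-1, 1, -3, 3) (0, 0) 4
    [5, 6, 7, 0, 1, 2, 3] (0, 1, 2, 11) (by decide +kernel)

theorem hasRupertProperty_J5 : HasRupertProperty J5 := by
  unfold J5
  exact hasRupertProperty_of_test (-12, 0, 0, -5) (1, -6, -7, 9) (0, 0) 3
    [4, 5, 6, 7, 8, 9, 0, 1, 2] (0, 1, 2, 14) (by decide +kernel)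

theorem hasRupertProperty_J6 : HasRupertProperty J6 := by
  unfold J6
  exact hasRupertProperty_of_test (-21, 0, 0, -13) (5, -15, 10, 17) (28812373, -58464340) 3
    [4, 5, 6, 7, 8, 9, 0, 1, 2] (0, 1, 2, 19) (by decide +kernel)

theorem hasRupertProperty_J7 : HasRupertProperty J7 := by
  unfold J7
  exact hasRupertProperty_of_test (-6, -7, 1, 4) (4, 0, 0, 9) (3965310, 2261730) 6
    [0, 3, 4, 5, 2] (0, 1, 2, 6) (by decide +kernel)

theorem hasRupertProperty_J8 : HasRupertProperty J8 := by
  unfold J8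
  exact hasRupertProperty_of_test (-2, -1, 3, -1) (0, -1, 0, 0) (4179, 4839) 1
    [8, 3, 7, 6, 5] (0, 1, 2, 8) (by decide +kernel)

theorem hasRupertProperty_J9 : HasRupertProperty J9 := by
  unfold J9
  exact hasRupertProperty_of_test (-5, -11, -4, -16) (15, 0, 0, 13) (-66928538, -9440374) 5
    [6, 7, 2, 10, 4, 9] (0, 1, 2, 10) (by decide +kernel)

theorem hasRupertProperty_J10 : HasRupertProperty J10 := by
  unfold J10
  exact hasRupertProperty_of_test (11, 10, 24, 16) (-6, -4, 1, 65) (-1267460451, -655371920) 7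
    [6, 2, 8, 0, 4] (0, 1, 2, 8) (by decide +kernel)

theorem hasRupertProperty_J11 : HasRupertProperty J11 := by
  unfold J11
  exact hasRupertProperty_of_test (-3, -59, 47, 26) (-56, -46, -15, -30) (20156568435, -16500301836)
    1
    [5, 9, 8, 3, 2] (0, 1, 2, 10) (by decide +kernel)

theorem hasRupertProperty_J12 : HasRupertProperty J12 := by
  unfold J12
  exact hasRupertProperty_of_test (-14, -13, 15, 5) (3, 8, 23, -4) (61378610, 21804147) 3
    [0, 4, 1] (0, 1, 2, 4) (by decide +kernel)

theorem hasRupertProperty_J13 : HasRupertProperty J13 := by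
  unfold J13
  exact hasRupertProperty_of_test (0, -13, -1, 0) (6, -6, -7, 7) (7113810, -1415655) 3
    [2, 1, 0, 4] (0, 1, 2, 6) (by decide +kernel)

theorem hasRupertProperty_J14 : HasRupertProperty J14 := by
  unfold J14
  exact hasRupertProperty_of_test (3, -2, -2, 1) (0, -1, -2, 0) (46375, -9377) 6
    [2, 5, 7, 3, 0] (0, 1, 2, 7) (by decide +kernel)

theorem hasRupertProperty_J15 : HasRupertProperty J15 := by
  unfold J15
  exact hasRupertProperty_of_test (-2, 2, 1, -1) (-1, 0, 0, -1) (7993, -6010) 8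
    [2, 6, 9, 4, 0] (0, 1, 2, 9) (by decide +kernel)

theorem hasRupertProperty_J16 : HasRupertProperty J16 := by
  unfold J16
  exact hasRupertProperty_of_test (6, -1, 7, -3) (0, 1, 3, 0) (-451286, 89278) 11
    [9, 4, 10, 2, 7] (0, 1, 2, 11) (by decide +kernel)

theorem hasRupertProperty_J17 : HasRupertProperty J17 := by
  unfold J17
  exact hasRupertProperty_of_test (-54, -101, -32, 91) (-5, -80, -127, 1) (103544992655,
    92955726545) 3
    [8, 1, 4, 9, 6] (0, 1, 2, 9) (by decide +kernel)

theorem hasRupertProperty_J18 : HasRupertProperty J18 := by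
  unfold J18
  exact hasRupertProperty_of_test (7, 3, 2, 0) (0, 5, 6, 0) (-567650, 1000308) 9
    [3, 14, 12, 0, 6, 7, 8] (0, 1, 2, 14) (by decide +kernel)

theorem hasRupertProperty_J19 : HasRupertProperty J19 := by
  unfold J19
  exact hasRupertProperty_of_test (-14, 4, 1, -13) (7, -5, 5, 0) (19989870, 8130627) 2
    [3, 11, 12, 13, 14, 15, 7, 0, 1] (0, 1, 2, 19) (by decide +kernel)

theorem hasRupertProperty_J20 : HasRupertProperty J20 := by
  unfold J20
  exact hasRupertProperty_of_test (-3, -1, -2, -13) (-7, 9, 1, -6) (-14466981, 6871526) 10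
    [11, 12, 13, 14, 4, 5, 6, 7, 8, 9, 19] (0, 1, 2, 24) (by decide +kernel)

theorem hasRupertProperty_J21 : HasRupertProperty J21 := by
  unfold J21
  exact hasRupertProperty_of_test (-8, -15, 35, 7) (0, 39, -10, 0) (606684115, -211109910) 20
    [0, 9, 19, 18, 17, 16, 15, 14, 4, 3, 21, 26] (0, 1, 2, 29) (by decide +kernel)

theorem hasRupertProperty_J22 : HasRupertProperty J22 := by
  unfold J22
  exact hasRupertProperty_of_test (129, 667, -1613, 968) (189, -973, -132, 2) (-182530041114862,
    1257049061562334) 7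
    [0, 12, 14, 3, 9, 8] (0, 1, 2, 14) (by decide +kernel)

theorem hasRupertProperty_J23 : HasRupertProperty J23 := by
  unfold J23
  exact hasRupertProperty_of_test (3227, 803, -1831, -1259) (1063, -2575, -1171, 2621)
    (-29529087477090200, -1220958467879499) 18
    [19, 6, 15, 8, 9, 10, 11, 3] (0, 1, 2, 19) (by decide +kernel)

theorem hasRupertProperty_J24 : HasRupertProperty J24 := by
  unfold J24
  exact hasRupertProperty_of_test (610, -1346, -1139, -721) (-800, 1131, -1300, -626)
    (-2925991827527, 23747848635214) 17
    [16, 15, 14, 13, 2, 1, 0, 20, 9, 8, 7] (0, 1, 2, 24) (by decide +kernel)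

theorem hasRupertProperty_J26 : HasRupertProperty J26 := by
  unfold J26
  exact hasRupertProperty_of_test (-11, -9, -7, 0) (14, -2, -4, -7) (1183637, -1418686) 7
    [3, 5, 4, 0, 6] (0, 1, 2, 7) (by decide +kernel)

theorem hasRupertProperty_J27 : HasRupertProperty J27 := by
  unfold J27
  exact hasRupertProperty_of_test (0, -25, 3, 0) (-11, -18, -2, 14) (26100232, -26733487) 2
    [1, 0, 5, 4, 3] (0, 1, 2, 11) (by decide +kernel)

theorem hasRupertProperty_J28 : HasRupertProperty J28 := by
  unfold J28
  exact hasRupertProperty_of_test (-4, 0, 0, 1) (3, -2, -2, 0) (0, 0) 4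
    [5, 6, 7, 0, 1, 2, 3] (0, 1, 2, 15) (by decide +kernel)

theorem hasRupertProperty_J29 : HasRupertProperty J29 := by
  unfold J29
  exact hasRupertProperty_of_test (0, 3, 2, 0) (3, -1, 3, 1) (0, 0) 5
    [4, 3, 2, 1, 0, 7, 6] (0, 1, 2, 15) (by decide +kernel)

theorem hasRupertProperty_J30 : HasRupertProperty J30 := by
  unfold J30
  exact hasRupertProperty_of_test (0, 9, -5, 0) (-7, -4, 6, -2) (0, 0) 3
    [2, 1, 0, 9, 8, 7, 6, 5, 4] (0, 1, 2, 19) (by decide +kernel)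

theorem hasRupertProperty_J31 : HasRupertProperty J31 := by
  unfold J31
  exact hasRupertProperty_of_test (0, -1, 10, 0) (-6, 2, -7, -4) (0, 0) 0
    [9, 8, 7, 6, 5, 4, 3, 2, 1] (0, 1, 2, 19) (by decide +kernel)

theorem hasRupertProperty_J32 : HasRupertProperty J32 := by
  unfold J32
  exact hasRupertProperty_of_test (0, 4, -1, 0) (1, -1, -2, 2) (-26562, -10126) 4
    [3, 2, 1, 0, 9, 8, 7, 6, 5] (0, 1, 2, 24) (by decide +kernel)

theorem hasRupertProperty_J33 : HasRupertProperty J33 := by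
  unfold J33
  exact hasRupertProperty_of_test (0, -10, -9, 0) (0, -5, -7, -9) (1910985, 4284328) 7
    [6, 5, 4, 3, 2, 1, 0, 9, 8] (0, 1, 2, 24) (by decide +kernel)

theorem hasRupertProperty_J34 : HasRupertProperty J34 := by
  unfold J34
  exact hasRupertProperty_of_test (24, 0, 0, 97) (22, -14, -33, -297) (0, 0) 0
    [1, 2, 3, 4, 5, 6, 7, 8, 9] (0, 1, 2, 29) (by decide +kernel)

theorem hasRupertProperty_J35 : HasRupertProperty J35 := by
  unfold J35
  exact hasRupertProperty_of_test (5, -2, 5, 2) (0, 8, 1, 0) (-1339145, -1326618) 16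
    [17, 10, 4, 14, 13, 1, 7] (0, 1, 2, 17) (by decide +kernel)

theorem hasRupertProperty_J36 : HasRupertProperty J36 := by
  unfold J36
  exact hasRupertProperty_of_test (3, -5, -3, -5) (0, -1, 4, 0) (-287768, -500934) 10
    [17, 15, 7, 1, 13, 14, 4] (0, 1, 2, 17) (by decide +kernel)

theorem hasRupertProperty_J37 : HasRupertProperty J37 := by
  unfold J37
  exact hasRupertProperty_of_test (-9, -8, -10, -5) (0, 5, -6, 0) (-8180898, 318252) 22
    [12, 4, 18, 17, 16, 0, 8, 20, 23] (0, 1, 2, 23) (by decide +kernel)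

theorem hasRupertProperty_J38 : HasRupertProperty J38 := by
  unfold J38
  exact hasRupertProperty_of_test (13, -1, -2, -1) (-9, 5, -8, -2) (14139367, 7397934) 5
    [6, 16, 17, 18, 19, 10, 11, 1, 2, 3, 4] (0, 1, 2, 29) (by decide +kernel)

theorem hasRupertProperty_J39 : HasRupertProperty J39 := by
  unfold J39
  exact hasRupertProperty_of_test (7, 0, -2, 11) (-9, 5, 8, 2) (-7391793, 14039587) 1
    [2, 3, 4, 5, 15, 16, 17, 18, 19, 10, 0] (0, 1, 2, 29) (by decide +kernel)

theorem hasRupertProperty_J40 : HasRupertProperty J40 := by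
  unfold J40
  exact hasRupertProperty_of_test (17, 14, -61, 2) (7, 0, 0, -11) (171084085, 60468163) 0
    [9, 8, 7, 17, 28, 33, 27, 14, 13, 12, 2, 1] (0, 1, 2, 34) (by decide +kernel)

theorem hasRupertProperty_J41 : HasRupertProperty J41 := by
  unfold J41
  exact hasRupertProperty_of_test (30, -11, -7, -38) (0, -9, -14, 0) (-59948976, -166067589) 17
    [28, 34, 29, 10, 11, 12, 2, 3, 4, 5, 6, 7] (0, 1, 2, 34) (by decide +kernel)

theorem hasRupertProperty_J42 : HasRupertProperty J42 := by
  unfold J42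
  exact hasRupertProperty_of_test (2, 1, -4, -4) (0, -5, -4, 0) (531331, -541304) 24
    [9, 19, 34, 35, 36, 37, 32, 14, 4, 22, 27, 28, 29, 25] (0, 1, 2, 39) (by decide +kernel)

theorem hasRupertProperty_J43 : HasRupertProperty J43 := by
  unfold J43
  exact hasRupertProperty_of_test (2, -3, 0, 2) (5, 0, 0, -6) (373954, -358955) 27
    [21, 3, 13, 31, 36, 35, 39, 33, 18, 8, 24, 29, 28] (0, 1, 2, 39) (by decide +kernel)

theorem hasRupertProperty_J44 : HasRupertProperty J44 := by
  unfold J44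
  exact hasRupertProperty_of_test (2, 23, -26, -35) (-35, 0, -1, -35) (1175915014, -1021819152) 12
    [0, 7, 15, 16, 17, 10, 3, 14] (0, 1, 2, 17) (by decide +kernel)

theorem hasRupertProperty_J46 : HasRupertProperty J46 := by
  unfold J46
  exact hasRupertProperty_of_test (1090, -208, -595, 324) (428, -907, -643, 520) (127715174788,
    -2681708221004) 22
    [4, 5, 6, 17, 18, 29, 19, 10, 11, 1, 2, 3] (0, 1, 2, 29) (by decide +kernel)

theorem hasRupertProperty_J48 : HasRupertProperty J48 := by
  unfold J48
  exact hasRupertProperty_of_test (-29, 34, -28, 38) (-56, 1, 0, -33) (-4729805335, 342834978) 39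
    [35, 34, 10, 0, 20, 25, 26, 27, 28, 22, 5, 15, 32, 38] (0, 1, 2, 39) (by decide +kernel)

theorem hasRupertProperty_J49 : HasRupertProperty J49 := by
  unfold J49
  exact hasRupertProperty_of_test (-23, -16, -6, -8) (21, 12, -17, 2) (-93260313, 68592293) 4
    [1, 2, 6, 3] (0, 1, 2, 6) (by decide +kernel)

theorem hasRupertProperty_J50 : HasRupertProperty J50 := by
  unfold J50
  exact hasRupertProperty_of_test (3, -12, -1, 2) (6, -1, 11, 4) (2153184, -2388577) 1
    [7, 3, 6, 2] (0, 1, 2, 7) (by decide +kernel)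

theorem hasRupertProperty_J51 : HasRupertProperty J51 := by
  unfold J51
  exact hasRupertProperty_of_test (-123, 61, -18, 144) (145, -85, 108, 1) (-115298770431,
    -185717880058) 5
    [6, 0, 7, 1, 8] (0, 1, 2, 8) (by decide +kernel)

theorem hasRupertProperty_J52 : HasRupertProperty J52 := by
  unfold J52
  exact hasRupertProperty_of_test (-4, -10, 21, 7) (16, 12, 13, -7) (13371363, -77831438) 0
    [10, 9, 8, 7, 2, 1] (0, 1, 2, 10) (by decide +kernel)

theorem hasRupertProperty_J53 : HasRupertProperty J53 := by
  unfold J53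
  exact hasRupertProperty_of_test (-7, -2, 2, 2) (1, 5, 3, -6) (-10043, 453048) 2
    [3, 4, 10, 5, 6, 11] (0, 1, 2, 11) (by decide +kernel)

theorem hasRupertProperty_J54 : HasRupertProperty J54 := by
  unfold J54
  exact hasRupertProperty_of_test (-11, 2, 3, -5) (-7, -8, -4, 5) (720768, 278484) 2
    [3, 9, 10, 11, 12, 0, 1] (0, 1, 2, 12) (by decide +kernel)

theorem hasRupertProperty_J55 : HasRupertProperty J55 := by
  unfold J55
  exact hasRupertProperty_of_test (-2, 1, -2, 4) (0, -3, 2, 4) (0, 0) 11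
    [12, 0, 1, 2, 13, 9, 10] (0, 1, 2, 13) (by decide +kernel)

theorem hasRupertProperty_J56 : HasRupertProperty J56 := by
  unfold J56
  exact hasRupertProperty_of_test (2, 1, 0, 2) (2, 1, 2, 0) (-15277, 3498) 13
    [2, 3, 4, 5, 12, 6, 7] (0, 1, 2, 13) (by decide +kernel)

theorem hasRupertProperty_J57 : HasRupertProperty J57 := by
  unfold J57
  exact hasRupertProperty_of_test (-8, 1, 0, 6) (7, -7, -3, 3) (-545074, -526915) 14
    [10, 11, 12, 0, 1, 13, 2, 3] (0, 1, 2, 14) (by decide +kernel)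

theorem hasRupertProperty_J58 : HasRupertProperty J58 := by
  unfold J58
  exact hasRupertProperty_of_test (-11, -1, -15, 7) (-2, 11, -14, -9) (84107, 2203961) 3
    [18, 2, 10, 8, 4, 21, 32, 13, 15] (0, 1, 2, 32) (by decide +kernel)

theorem hasRupertProperty_J59 : HasRupertProperty J59 := by
  unfold J59
  exact hasRupertProperty_of_test (-23, -12, -15, 3) (1, 8, 11, -27) (0, 0) 7
    [22, 33, 10, 8, 0, 17, 32, 13, 15] (0, 1, 2, 33) (by decide +kernel)

theorem hasRupertProperty_J60 : HasRupertProperty J60 := by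
  unfold J60
  exact hasRupertProperty_of_test (28, 16, 19, 34) (49, -11, 1, -2) (-18067076, -3596007) 32
    [5, 29, 28, 33, 14, 2, 26, 27, 1] (0, 1, 2, 33) (by decide +kernel)

theorem hasRupertProperty_J61 : HasRupertProperty J61 := by
  unfold J61
  exact hasRupertProperty_of_test (39, 12, -27, -10) (-42, 15, 21, -4) (185956382, -34500229) 33
    [10, 2, 34, 3, 11, 13, 32, 21, 4] (0, 1, 2, 34) (by decide +kernel)

theorem hasRupertProperty_J62 : HasRupertProperty J62 := by
  unfold J62
  exact hasRupertProperty_of_test (-6, -18, 0, -7) (-8, -2, -18, 3) (10071825, 7209779) 18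
    [10, 0, 16, 9, 5] (0, 1, 2, 19) (by decide +kernel)

theorem hasRupertProperty_J63 : HasRupertProperty J63 := by
  unfold J63
  exact hasRupertProperty_of_test (-19, 8, 57, 23) (-23, 1, 34, 50) (-1383672111, 515356844) 12
    [1, 2, 16, 9, 3] (0, 1, 2, 17) (by decide +kernel)

theorem hasRupertProperty_J64 : HasRupertProperty J64 := by
  unfold J64
  exact hasRupertProperty_of_test (-1, 15, 16, 11) (2, -14, -17, 11) (-21216144, 26160921) 2
    [16, 8, 0, 18, 14, 4] (0, 1, 2, 18) (by decide +kernel)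

theorem hasRupertProperty_J65 : HasRupertProperty J65 := by
  unfold J65
  exact hasRupertProperty_of_test (-13, 1, 0, 0) (-9, -8, 5, -2) (-7790121, -24219655) 12
    [14, 5, 9, 8, 4, 6, 10] (0, 1, 2, 14) (by decide +kernel)

theorem hasRupertProperty_J66 : HasRupertProperty J66 := by
  unfold J66
  exact hasRupertProperty_of_test (-4, 3, 1, -6) (6, 0, 0, -5) (-110042, 148977) 26
    [4, 12, 13, 21, 23, 7, 3, 11, 10, 18, 16, 24] (0, 1, 2, 27) (by decide +kernel)

theorem hasRupertProperty_J67 : HasRupertProperty J67 := by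
  unfold J67
  exact hasRupertProperty_of_test (1, -5, -3, -6) (0, 3, -8, 0) (0, 0) 31
    [28, 30, 5, 13, 12, 4, 26, 25, 27, 2, 10, 11, 3] (0, 1, 2, 31) (by decide +kernel)

theorem hasRupertProperty_J68 : HasRupertProperty J68 := by
  unfold J68
  exact hasRupertProperty_of_test (-2, 5, 7, -4) (2, -4, -6, 7) (91910, 99520) 50
    [26, 30, 54, 70, 46, 20, 21, 45, 69, 53, 81, 79, 49, 65, 41, 19, 18, 42, 66] (0, 1, 2, 81) (by
    decide +kernel)

theorem hasRupertProperty_J69 : HasRupertProperty J69 := by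
  unfold J69
  exact hasRupertProperty_of_test (-1, 14, 3, -6) (6, -12, -5, 8) (0, 0) 70
    [46, 44, 68, 60, 36, 37, 12, 72, 74, 78, 49, 65, 41, 43, 67, 59, 35, 34, 11, 83, 87, 91, 54] (0,
    1, 2, 91) (by decide +kernel)

theorem hasRupertProperty_J70 : HasRupertProperty J70 := by
  unfold J70
  exact hasRupertProperty_of_test (-21, -9, -20, -1) (13, -2, 1, -7) (0, 0) 31
    [55, 63, 39, 38, 62, 54, 83, 90, 0, 24, 48, 56, 32, 33, 75, 79, 25, 5, 7] (0, 1, 2, 91) (by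
    decide +kernel)

theorem hasRupertProperty_J78 : HasRupertProperty J78 := by
  unfold J78
  exact hasRupertProperty_of_test (-18, -57, -18, 17) (21, 27, 49, -25) (1367525333, 651007255) 38
    [60, 61, 63, 29, 9, 6, 52, 33, 21, 43, 23, 28, 8, 11, 59] (0, 1, 2, 65) (by decide +kernel)

theorem hasRupertProperty_J79 : HasRupertProperty J79 := by
  unfold J79
  exact hasRupertProperty_of_test (34, -12, -9, -14) (7, -7, -7, -16) (46556046, -31314658) 52
    [11, 8, 26, 21, 37, 19, 31, 49, 6, 9, 27, 57, 55, 54, 34] (0, 1, 2, 65) (by decide +kernel)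

theorem hasRupertProperty_J80 : HasRupertProperty J80 := by
  unfold J80
  exact hasRupertProperty_of_test (-21, 34, -53, 44) (-72, -19, 17, 23) (0, 0) 21
    [41, 13, 12, 40, 22, 2, 6, 26, 46, 18, 19, 47, 25, 5, 1] (0, 1, 2, 59) (by decide +kernel)

theorem hasRupertProperty_J81 : HasRupertProperty J81 := by
  unfold J81
  exact hasRupertProperty_of_test (48, 16, 23, -57) (-7, -39, -10, -69) (1878061141, -2136657750) 8
    [7, 54, 34, 22, 40, 20, 26, 6, 9, 57, 37, 24, 45, 25, 31, 11] (0, 1, 2, 59) (by decide +kernel)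

theorem hasRupertProperty_J82 : HasRupertProperty J82 := by
  unfold J82
  exact hasRupertProperty_of_test (4, 28, 10, -1) (1, 14, 5, 26) (50773564, -43696836) 52
    [34, 16, 14, 32, 50, 9, 6, 49, 31, 13, 59, 56, 54, 8, 11] (0, 1, 2, 59) (by decide +kernel)

theorem hasRupertProperty_J83 : HasRupertProperty J83 := by
  unfold J83
  exact hasRupertProperty_of_test (-40, 38, -33, -76) (-80, -34, 36, -33) (-5624428866, -79902718) 6
    [9, 50, 33, 22, 4, 5, 23, 29, 11, 10, 7, 25, 20, 2, 0, 18, 24] (0, 1, 2, 53) (by decide +kernel)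

theorem hasRupertProperty_J84 : HasRupertProperty J84 := by
  unfold J84
  dsimp only
  exact hasRupertProperty_of_test (4, 1, 4, -2) (-1, 1, -1, 1) (43582, 44741) 3
    [4, 2, 6, 7] (0, 1, 2, 7) (by decide +kernel)

theorem hasRupertProperty_J85 : HasRupertProperty J85 := by
  unfold J85
  dsimp only
  exact hasRupertProperty_of_test (-1, -8, -18, -3) (4, 7, 12, 13) (14042833, 12199267) 7
    [11, 6, 10, 5, 9, 4, 8] (0, 1, 2, 15) (by decide +kernel)

theorem hasRupertProperty_J86 : HasRupertProperty J86 := by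
  unfold J86
  dsimp only
  -- The list of `spheno` begins with points of first coordinate `0`, each of which appears twice
  -- because `-0 = 0`. The first four entries are thus only two points, and the spanning vertices
  -- are chosen among others as well.
  exact hasRupertProperty_of_test (0, 5, -9, 1) (-2, -7, 2, -7) (-17591, 12305) 4
    [5, 9, 7, 6, 10] (0, 6, 4, 1) (by decide +kernel)

theorem hasRupertProperty_J87 : HasRupertProperty J87 := by
  unfold J87
  dsimp only
  exact hasRupertProperty_of_test (-9, -16, 8, -4) (1, 15, 6, -11) (-21737604, 2411179) 6
    [0, 16, 5, 11, 15] (0, 6, 4, 1) (by decide +kernel)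

theorem hasRupertProperty_J88 : HasRupertProperty J88 := by
  unfold J88
  dsimp only
  exact hasRupertProperty_of_test (-2, -1, -2, 1) (-1, -1, -2, -2) (14900, 18080) 17
    [9, 1, 0, 10, 18, 15] (0, 6, 4, 1) (by decide +kernel)

theorem hasRupertProperty_J89 : HasRupertProperty J89 := by
  unfold J89
  dsimp only
  exact hasRupertProperty_of_test (-13, 10, 24, 6) (-3, 27, -11, 4) (-188365437, 104807090) 1
    [9, 13, 18, 14, 10, 0] (0, 1, 2, 19) (by decide +kernel)

theorem hasRupertProperty_J90 : HasRupertProperty J90 := by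
  unfold J90
  dsimp only
  exact hasRupertProperty_of_test (-22, -18, -26, 11) (-12, -34, 17, -1) (-584895959, 160732181) 19
    [9, 1, 0, 10, 16, 13, 17] (0, 6, 4, 1) (by decide +kernel)

theorem hasRupertProperty_J91 : HasRupertProperty J91 := by
  unfold J91
  -- The first eight entries represent only the two points `(0, 0, ± φ)`, so two of the spanning
  -- vertices come from the next group.
  exact hasRupertProperty_of_test (-1, -6, -2, 0) (-3, 3, -1, -4) (0, 0) 22
    [20, 12, 8, 17, 19, 11, 15] (0, 10, 8, 1) (by decide +kernel)

theorem hasRupertProperty_J92 : HasRupertProperty J92 := by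
  unfold J92
  exact hasRupertProperty_of_test (-5, -1, -11, 4) (-1, -6, -3, 11) (21473725, 29597614) 11
    [5, 8, 9, 3, 6, 10, 4, 7] (0, 1, 2, 17) (by decide +kernel)

theorem hasRupertProperty_vertices (n : ℕ) (h₁ : 1 ≤ n) (h₂ : n ≤ 92)
    (hn : n ∉ ({25, 45, 47, 71, 72, 73, 74, 75, 76, 77} : Set ℕ)) :
    HasRupertProperty (vertices n) := by
  simp only [Set.mem_insert_iff, Set.mem_singleton_iff, not_or] at hn
  obtain ⟨a₁, a₂, a₃, a₄, a₅, a₆, a₇, a₈, a₉, a₁₀⟩ := hn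
  interval_cases n
  · exact hasRupertProperty_J1
  · exact hasRupertProperty_J2
  · exact hasRupertProperty_J3
  · exact hasRupertProperty_J4
  · exact hasRupertProperty_J5
  · exact hasRupertProperty_J6
  · exact hasRupertProperty_J7
  · exact hasRupertProperty_J8
  · exact hasRupertProperty_J9
  · exact hasRupertProperty_J10
  · exact hasRupertProperty_J11
  · exact hasRupertProperty_J12
  · exact hasRupertProperty_J13
  · exact hasRupertProperty_J14
  · exact hasRupertProperty_J15
  · exact hasRupertProperty_J16
  · exact hasRupertProperty_J17
  · exact hasRupertProperty_J18
  · exact hasRupertProperty_J19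
  · exact hasRupertProperty_J20
  · exact hasRupertProperty_J21
  · exact hasRupertProperty_J22
  · exact hasRupertProperty_J23
  · exact hasRupertProperty_J24
  · exact absurd rfl a₁
  · exact hasRupertProperty_J26
  · exact hasRupertProperty_J27
  · exact hasRupertProperty_J28
  · exact hasRupertProperty_J29
  · exact hasRupertProperty_J30
  · exact hasRupertProperty_J31
  · exact hasRupertProperty_J32
  · exact hasRupertProperty_J33
  · exact hasRupertProperty_J34
  · exact hasRupertProperty_J35
  · exact hasRupertProperty_J36
  · exact hasRupertProperty_J37
  · exact hasRupertProperty_J38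
  · exact hasRupertProperty_J39
  · exact hasRupertProperty_J40
  · exact hasRupertProperty_J41
  · exact hasRupertProperty_J42
  · exact hasRupertProperty_J43
  · exact hasRupertProperty_J44
  · exact absurd rfl a₂
  · exact hasRupertProperty_J46
  · exact absurd rfl a₃
  · exact hasRupertProperty_J48
  · exact hasRupertProperty_J49
  · exact hasRupertProperty_J50
  · exact hasRupertProperty_J51
  · exact hasRupertProperty_J52
  · exact hasRupertProperty_J53
  · exact hasRupertProperty_J54
  · exact hasRupertProperty_J55
  · exact hasRupertProperty_J56
  · exact hasRupertProperty_J57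
  · exact hasRupertProperty_J58
  · exact hasRupertProperty_J59
  · exact hasRupertProperty_J60
  · exact hasRupertProperty_J61
  · exact hasRupertProperty_J62
  · exact hasRupertProperty_J63
  · exact hasRupertProperty_J64
  · exact hasRupertProperty_J65
  · exact hasRupertProperty_J66
  · exact hasRupertProperty_J67
  · exact hasRupertProperty_J68
  · exact hasRupertProperty_J69
  · exact hasRupertProperty_J70
  · exact absurd rfl a₄
  · exact absurd rfl a₅
  · exact absurd rfl a₆
  · exact absurd rfl a₇
  · exact absurd rfl a₈
  · exact absurd rfl a₉
  · exact absurd rfl a₁₀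
  · exact hasRupertProperty_J78
  · exact hasRupertProperty_J79
  · exact hasRupertProperty_J80
  · exact hasRupertProperty_J81
  · exact hasRupertProperty_J82
  · exact hasRupertProperty_J83
  · exact hasRupertProperty_J84
  · exact hasRupertProperty_J85
  · exact hasRupertProperty_J86
  · exact hasRupertProperty_J87
  · exact hasRupertProperty_J88
  · exact hasRupertProperty_J89
  · exact hasRupertProperty_J90
  · exact hasRupertProperty_J91
  · exact hasRupertProperty_J92

end JohnsonSolids

/-! ### All similar copies, and the count of solids -/

theorem mainTheorem4 :
    (∀ n ∈ Set.Icc 1 92, n ∉ ({25, 45, 47, 71, 72, 73, 74, 75, 76, 77} : Set ℕ) →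
      ∀ P : Set JohnsonSolids.Space,
        JohnsonSolids.IsJohnsonSolid n P → JohnsonSolids.HasRupertProperty P) ∧
    82 ≤ Set.ncard {n : ℕ | n ∈ Set.Icc 1 92 ∧
      ∀ P : Set JohnsonSolids.Space,
        JohnsonSolids.IsJohnsonSolid n P → JohnsonSolids.HasRupertProperty P} := by
  have key : ∀ n ∈ Set.Icc 1 92, n ∉ ({25, 45, 47, 71, 72, 73, 74, 75, 76, 77} : Set ℕ) →
      ∀ P : Set JohnsonSolids.Space,
        JohnsonSolids.IsJohnsonSolid n P → JohnsonSolids.HasRupertProperty P := by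
    rintro n ⟨h₁, h₂⟩ hn P ⟨c, f, hc, rfl⟩
    exact (JohnsonSolids.hasRupertProperty_vertices n h₁ h₂ hn).similar hc f
  refine ⟨key, ?_⟩
  let S : Finset ℕ := Finset.Icc 1 92 \ {25, 45, 47, 71, 72, 73, 74, 75, 76, 77}
  have hS : S.card = 82 := by decide +kernel
  rw [← hS, ← Set.ncard_coe_finset]
  -- Monotonicity of `ncard` needs the larger set to be finite, since infinite sets have `ncard`
  -- zero; here it is contained in `Icc 1 92`.
  refine Set.ncard_le_ncard (fun n hn => ?_) ((Set.finite_Icc 1 92).subset fun n hn => hn.1)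
  simp only [S, Finset.coe_sdiff, Finset.coe_Icc, Set.mem_sdiff] at hn
  refine ⟨hn.1, key n hn.1 fun h => hn.2 ?_⟩
  simpa using h
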